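/- Let $X$ be a real Banach space, let $\lambda$ be Lebesgue measure on $[0,1]$, and let $cwk(X)$ be the family of nonempty convex weakly compact subsets of $X$, with Minkowski addition, multiplication by scalars and the Hausdorff distance $d_H$; put $\|A\|=d_H(A,\{0\})$. A *partition in* $[0,1]$ is a finite collection $\{(I_i,t_i)\}_{i\le p}$ of pairwise nonoverlapping closed subintervals $I_i$ of $[0,1]$ and points $t_i\in[0,1]$. It is a partition *of* $[0,1]$ if $\bigcup_i I_i=[0,1]$, and it is *Perron* if $t_i\in I_i$ for all $i$. For a gauge (a positive function) $\delta$ on $[0,1]$ it is *$\delta$-fine* if $I_i\subset(t_i-\delta(t_i),t_i+\delta(t_i))$ for all $i$. Consider multifunctions $\Gamma:[0,1]\to cwk(X)$. - $\Gamma$ is *McShane integrable* on $[0,1]$ if there is a nonempty closed convex set $A\subset X$ (the integral) such that for every $\varepsilon>0$ there is a gauge $\delta$ with $d_H\big(A,\sum_i\Gamma(t_i)|I_i|\big)<\varepsilon$ for every $\delta$-fine partition $\{(I_i,t_i)\}$ of $[0,1]$. The integral of $\Gamma$ on a closed interval $I\subset[0,1]$ is the integral on $[0,1]$ of $\Gamma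 1_I$, the multifunction equal to $\Gamma$ on $I$ and to $\{0\}$ off $I$. - $\Gamma$ is *variationally Henstock integrable* if there is a finitely additive map $\Phi$ from the closed subintervals of $[0,1]$ to $cwk(X)$ such that for every $\varepsilon>0$ there is a gauge $\delta$ with $\sum_i d_H\big(\Phi(I_i),\Gamma(t_i)|I_i|\big)<\varepsilon$ for every $\delta$-fine Perron partition of $[0,1]$. - $\Gamma$ is *Bochner measurable* if there are simple multifunctions $\Gamma_n:[0,1]\to cwk(X)$ (finitely many values, each taken on a Lebesgue measurable set) with $d_H(\Gamma_n(t),\Gamma(t))\to0$ for almost all $t$. - The *variational measure* of an interval map $\Phi$ with values in $cwk(X)$ is $V_\Phi(E)=\inf_\delta\sup\sum_i\|\Phi(I_i)\|$ for $E\subset[0,1]$, where $\delta$ runs over the gauges and the supremum is over the $\delta$-fine Perron partitions in $[0,1]$ with all $t_i\in E$. It is *$\lambda$-continuous* if $V_\Phi(E)=0$ whenever $E$ is Lebesgue measurable with $\lambda(E)=0$. **Theorem.** Let $\Gamma:[0,1]\to cwk(X)$ be McShane integrable. Then the integral of $\Gamma$ on each closed interval $I\subset[0,1]$ exists, is unique,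 and belongs to $cwk(X)$; denote it by $\Phi_\Gamma(I)$. Moreover, $\Gamma$ is variationally Henstock integrable if and only if $\Gamma$ is Bochner measurable and the variational measure $V_{\Phi_\Gamma}$ is $\lambda$-continuous. -/

import Mathlib

open Set Filter Topology MeasureTheory
open scoped Pointwise ENNReal unitInterval

/-- `cwk(X)`: the nonempty convex weakly compact subsets of `X`. -/
abbrev CWK (X : Type*) [NormedAddCommGroup X] [NormedSpace ℝ X] : Type _ :=
  {A : Set X // A.Nonempty ∧ Convex ℝ A ∧ IsCompact (toWeakSpace ℝ X '' A)}

/-- The closed subintervals `[a, b]` of `[0,1]`, with `a ≤ b`. -/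
abbrev ClosedSubinterval : Type := NonemptyInterval I

namespace ClosedSubinterval

/-- The length `|J|` of `J`. -/
def length (J : ClosedSubinterval) : ℝ := (J.snd : ℝ) - (J.fst : ℝ)

/-- Two intervals are nonoverlapping when the corresponding open intervals are disjoint. -/
def NonOverlapping (J K : ClosedSubinterval) : Prop :=
  Disjoint (Set.Ioo J.fst J.snd) (Set.Ioo K.fst K.snd)

end ClosedSubinterval

/-- A finite collection of pairs (interval, tag). -/
abbrev TaggedFamily : Type := Finset (ClosedSubinterval × I)

namespace TaggedFamily

/-- A partition in `[0,1]`: the intervals are pairwise nonoverlapping; the tags are arbitrary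
points of `[0,1]`. -/
def IsPartitionIn (P : TaggedFamily) : Prop :=
  ∀ p ∈ P, ∀ q ∈ P, p ≠ q → p.1.NonOverlapping q.1

/-- A partition of `[0,1]`: a partition in `[0,1]` whose intervals cover `[0,1]`. -/
def IsPartitionOf (P : TaggedFamily) : Prop :=
  P.IsPartitionIn ∧ (⋃ p ∈ P, (p.1 : Set I)) = Set.univ

/-- The Perron condition: each tag belongs to its interval. -/
def IsPerron (P : TaggedFamily) : Prop :=
  ∀ p ∈ P, p.2 ∈ (p.1 : Set I)

/-- `P` is `δ`-fine: each interval is contained in `(t - δ(t), t + δ(t))`, where `t` is its tag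
(`Metric.ball` is taken in the metric space `[0,1]`). -/
def IsFine (δ : I → ℝ) (P : TaggedFamily) : Prop :=
  ∀ p ∈ P, (p.1 : Set I) ⊆ Metric.ball p.2 (δ p.2)

end TaggedFamily

/-- A gauge on `[0,1]` is an arbitrary positive function. -/
def IsGauge (δ : I → ℝ) : Prop := ∀ t, 0 < δ t

section

variable {X : Type*} [NormedAddCommGroup X] [NormedSpace ℝ X]

/-- The nonempty closed convex set `A` is a McShane integral on `[0,1]` of the multifunction `Γ`.
The Riemann sums are Minkowski sums, and the Hausdorff distance is `[0, ∞]`-valued, so that an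
unbounded `A` is at distance `∞` from every bounded set. -/
def IsMcShaneIntegral (Γ : I → Set X) (A : Set X) : Prop :=
  A.Nonempty ∧ IsClosed A ∧ Convex ℝ A ∧
    ∀ ε : ℝ, 0 < ε → ∃ δ : I → ℝ, IsGauge δ ∧
      ∀ P : TaggedFamily, P.IsPartitionOf → P.IsFine δ →
        Metric.hausdorffEDist A (∑ p ∈ P, p.1.length • Γ p.2) < ENNReal.ofReal ε

/-- McShane integrability on `[0,1]`. -/
def McShaneIntegrable (Γ : I → CWK X) : Prop :=
  ∃ A : Set X, IsMcShaneIntegral (fun t => (Γ t : Set X)) A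

open Classical in
/-- The multifunction `Γ 1_E`, equal to `Γ` on `E` and to `{0}` off `E`. -/
noncomputable def restrictMulti (Γ : I → CWK X) (E : Set I) : I → Set X :=
  fun t => if t ∈ E then (Γ t : Set X) else {0}

/-- `Φ` is the integral (primitive) of `Γ` as an interval multifunction: `Φ(J)` is the McShane
integral of `Γ` on `J`, that is, of `Γ 1_J` on `[0,1]`. -/
def IsMcShanePrimitive (Γ : I → CWK X) (Φ : ClosedSubinterval → CWK X) : Prop :=
  ∀ J : ClosedSubinterval, IsMcShaneIntegral (restrictMulti Γ (J : Set I)) (Φ J : Set X)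

/-- Finite additivity of an interval multifunction, with respect to Minkowski addition. -/
def IsAdditive (Φ : ClosedSubinterval → CWK X) : Prop :=
  ∀ J K L : ClosedSubinterval, J.NonOverlapping K → (J : Set I) ∪ (K : Set I) = (L : Set I) →
    (Φ L : Set X) = (Φ J : Set X) + (Φ K : Set X)

/-- Variational Henstock integrability on `[0,1]`. -/
def VariationallyHenstockIntegrable (Γ : I → CWK X) : Prop :=
  ∃ Φ : ClosedSubinterval → CWK X, IsAdditive Φ ∧
    ∀ ε : ℝ, 0 < ε → ∃ δ : I → ℝ, IsGauge δ ∧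
      ∀ P : TaggedFamily, P.IsPartitionOf → P.IsPerron → P.IsFine δ →
        ∑ p ∈ P, Metric.hausdorffEDist (Φ p.1 : Set X) (p.1.length • (Γ p.2 : Set X))
          < ENNReal.ofReal ε

/-- A simple multifunction: finitely many values, each taken on a Lebesgue measurable set. -/
def IsSimpleMulti (G : I → CWK X) : Prop :=
  (Set.range G).Finite ∧ ∀ A : CWK X, NullMeasurableSet (G ⁻¹' {A}) (volume : Measure I)

/-- Bochner measurability: almost everywhere limit, in the Hausdorff metric, of a sequence of
simple multifunctions. -/
def BochnerMeasurable (Γ : I → CWK X) : Prop :=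
  ∃ G : ℕ → I → CWK X, (∀ n, IsSimpleMulti (G n)) ∧
    ∀ᵐ t ∂(volume : Measure I),
      Tendsto (fun n => Metric.hausdorffEDist (G n t : Set X) (Γ t : Set X)) atTop (𝓝 0)

/-- The variational measure `V_Φ(E) = inf_δ sup_P ∑ ‖Φ(J_i)‖`, where `δ` runs over the gauges,
`P = {(J_i, t_i)}` over the `δ`-fine Perron partitions in `[0,1]` with all tags in `E`, and
`‖A‖` is the Hausdorff distance from `A` to `{0}`. -/
noncomputable def variationalMeasure (Φ : ClosedSubinterval → CWK X) (E : Set I) : ℝ≥0∞ :=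
  ⨅ (δ : I → ℝ) (_ : IsGauge δ),
    ⨆ (P : TaggedFamily) (_ : P.IsPartitionIn ∧ P.IsPerron ∧ P.IsFine δ ∧ ∀ p ∈ P, p.2 ∈ E),
      ∑ p ∈ P, Metric.hausdorffEDist (Φ p.1 : Set X) {0}

/-- The variational measure of `Φ` is `λ`-continuous: it vanishes on Lebesgue null sets. -/
def VariationalMeasureContinuous (Φ : ClosedSubinterval → CWK X) : Prop :=
  ∀ E : Set I, NullMeasurableSet E (volume : Measure I) → volume E = 0 →
    variationalMeasure Φ E = 0

end

/-!
A weakly compact convex set is determined by its support function on the dual unit ball, and this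
identification (`CWK.embed`) turns Minkowski sums into sums and the Hausdorff distance into the
supremum norm (`CWK.edist_embed`, by Hahn–Banach). Its range is closed
(`CWK.isClosed_range_embed`): a closed convex set approximated by weakly compact sets is weakly
compact. So a limit of Riemann sums is again a weakly compact set, which gives existence and
uniqueness of the integrals over subintervals, and everything else is a statement about the function
`g = embed ∘ Γ` with values in a Banach space and a point function `F` whose increments are the
integrals of `g`.

Both implications go through the property that `F` is differentiable with derivative `g` at almost
every point.

* If `g` is variationally Henstock integrable, a Vitali covering argument shows that `F` has this
  property (`TaggedList.VariationalHenstock.ae_hasIntervalDeriv`); hence `Γ` is almost everywhere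
  the limit of the simple multifunctions given by difference quotients over grid cells. On a null
  set the Riemann sums of `g` are negligible for a suitable gauge
  (`TaggedList.exists_gauge_sum_le_of_null`), so the variational measure of `F` vanishes there.

* Conversely, if `F` is differentiable with derivative `g` off a null set `N`, then the variational
  condition holds for tags off `N` by differentiability, and for tags in `N` because the variational
  measure of `N` is zero (`TaggedList.NullVariation.variationalHenstock`).

The main point is that a McShane primitive `F` of a strongly measurable `g` is differentiable almost
everywhere when its variational measure is `λ`-continuous. This is false for general McShane
primitives. First, `λ`-continuity forces the difference quotients of `F` to be bounded at almost
every point: otherwise Vitali's and Baire's theorems produce a null set of positive variational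
measure (`TaggedList.NullVariation.ae_exists_mem_lipschitzPoints`). Hence almost all of `[0,1]` is
covered by countably many closed sets `E` on each of which `g` is within `ε` of a constant `y` and
`F` satisfies a one-point Lipschitz condition. By the Saks–Henstock lemma, the difference between
the increment of `F` and `|J| y`, over an interval `J` with an end point in `E`, is at most `ε |J|` plus a
constant multiple of `λ(J \ E)` (`TaggedList.SaksHenstock.norm_sub_le_of_mem`), and the last term is
`o(|J|)` at the density points of `E`.
-/

/-! ### Increments and tagged families written as lists -/

namespace ClosedSubinterval

/-- The increment `F(b) - F(a)` of a point function `F` over `[a, b]`. -/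
def increment {Y : Type*} [AddCommGroup Y] (F : I → Y) (J : ClosedSubinterval) : Y :=
  F J.snd - F J.fst

theorem length_nonneg (J : ClosedSubinterval) : 0 ≤ J.length :=
  sub_nonneg.2 J.fst_le_snd

theorem NonOverlapping.symm {J K : ClosedSubinterval} (h : J.NonOverlapping K) :
    K.NonOverlapping J :=
  Disjoint.symm h

theorem NonOverlapping.le_or_le {J K : ClosedSubinterval} (h : J.NonOverlapping K)
    (hJ : J.fst < J.snd) (hK : K.fst < K.snd) : J.snd ≤ K.fst ∨ K.snd ≤ J.fst := by
  by_contra! hc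
  have hlt : max J.fst K.fst < min J.snd K.snd :=
    max_lt (lt_min hJ hc.2) (lt_min hc.1 hK)
  obtain ⟨x, hx1, hx2⟩ := exists_between hlt
  exact Set.disjoint_left.1 h
    ⟨(le_max_left _ _).trans_lt hx1, hx2.trans_le (min_le_left _ _)⟩
    ⟨(le_max_right _ _).trans_lt hx1, hx2.trans_le (min_le_right _ _)⟩

theorem nonOverlapping_of_le {J K : ClosedSubinterval} (h : J.snd ≤ K.fst) :
    J.NonOverlapping K :=
  Set.disjoint_left.2 fun _ hx hy => absurd (hx.2.trans_le h) (not_lt.2 hy.1.le)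

theorem NonOverlapping.mono {J K J' K' : ClosedSubinterval} (h : J.NonOverlapping K)
    (hJ : Set.Ioo J'.fst J'.snd ⊆ Set.Ioo J.fst J.snd)
    (hK : Set.Ioo K'.fst K'.snd ⊆ Set.Ioo K.fst K.snd) : J'.NonOverlapping K' :=
  Disjoint.mono hJ hK h

theorem nonOverlapping_of_snd_le_fst {J K : ClosedSubinterval} (h : J.snd ≤ J.fst) :
    J.NonOverlapping K := by
  unfold NonOverlapping
  rw [Set.Ioo_eq_empty (not_lt.2 h)]
  exact Set.empty_disjoint _

end ClosedSubinterval

namespace TaggedList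

/-- The intervals of a list of tagged intervals are pairwise nonoverlapping. Lists allow repeated
degenerate intervals, which contribute nothing to the sums considered here. -/
def NonOverlapping (L : List (ClosedSubinterval × I)) : Prop :=
  L.Pairwise fun p q => p.1.NonOverlapping q.1

/-- The list version of `TaggedFamily.IsFine`. -/
def IsFine (δ : I → ℝ) (L : List (ClosedSubinterval × I)) : Prop :=
  ∀ p ∈ L, (p.1 : Set I) ⊆ Metric.ball p.2 (δ p.2)

/-- The list version of `TaggedFamily.IsPerron`. -/
def IsPerron (L : List (ClosedSubinterval × I)) : Prop :=
  ∀ p ∈ L, p.2 ∈ (p.1 : Set I)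

/-- `L` is a list of nonoverlapping intervals that tile `[a, b]`. The covering condition is
stated with half-open intervals, so that degenerate intervals play no role in it. -/
structure Tiles (a b : I) (L : List (ClosedSubinterval × I)) : Prop where
  nonOverlapping : NonOverlapping L
  bounds : ∀ p ∈ L, a ≤ p.1.fst ∧ p.1.snd ≤ b
  cover : ∀ x, a ≤ x → x < b → ∃ p ∈ L, p.1.fst ≤ x ∧ x < p.1.snd

theorem NonOverlapping.perm {L L' : List (ClosedSubinterval × I)} (h : L.Perm L')
    (hL : NonOverlapping L) : NonOverlapping L' :=
  (h.pairwise_iff fun hx => hx.symm).1 hL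

theorem NonOverlapping.filter {L : List (ClosedSubinterval × I)} (hL : NonOverlapping L)
    (s : ClosedSubinterval × I → Bool) : NonOverlapping (L.filter s) :=
  List.Pairwise.filter s hL

theorem nonOverlapping_append {L L' : List (ClosedSubinterval × I)} :
    NonOverlapping (L ++ L') ↔ NonOverlapping L ∧ NonOverlapping L' ∧
      ∀ p ∈ L, ∀ q ∈ L', p.1.NonOverlapping q.1 :=
  List.pairwise_append

theorem Tiles.nil (a : I) : Tiles a a [] :=
  ⟨List.Pairwise.nil, by simp, fun x h h' => absurd (h.trans_lt h') (lt_irrefl _)⟩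

theorem Tiles.append {a b c : I} {L L' : List (ClosedSubinterval × I)} (hab : a ≤ b) (hbc : b ≤ c)
    (hL : Tiles a b L) (hL' : Tiles b c L') : Tiles a c (L ++ L') where
  nonOverlapping := nonOverlapping_append.2 ⟨hL.nonOverlapping, hL'.nonOverlapping,
    fun p hp q hq => ClosedSubinterval.nonOverlapping_of_le
      ((hL.bounds p hp).2.trans (hL'.bounds q hq).1)⟩
  bounds p hp := by
    rcases List.mem_append.1 hp with h | h
    · exact ⟨(hL.bounds p h).1, (hL.bounds p h).2.trans hbc⟩
    · exact ⟨hab.trans (hL'.bounds p h).1, (hL'.bounds p h).2⟩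
  cover x hx hx' := by
    rcases lt_or_ge x b with h | h
    · obtain ⟨p, hp, h1⟩ := hL.cover x hx h
      exact ⟨p, List.mem_append_left _ hp, h1⟩
    · obtain ⟨p, hp, h1⟩ := hL'.cover x h hx'
      exact ⟨p, List.mem_append_right _ hp, h1⟩

theorem Tiles.singleton (J : ClosedSubinterval) (t : I) : Tiles J.fst J.snd [(J, t)] :=
  ⟨List.pairwise_singleton _ _, by simp, fun x h h' => ⟨(J, t), by simp, h, h'⟩⟩

theorem Tiles.perm {a b : I} {L L' : List (ClosedSubinterval × I)} (h : Tiles a b L)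
    (hp : L.Perm L') : Tiles a b L' :=
  ⟨h.nonOverlapping.perm hp, fun p hq => h.bounds p (hp.mem_iff.2 hq),
    fun x hx hx' => by
      obtain ⟨p, h1, h2⟩ := h.cover x hx hx'
      exact ⟨p, hp.mem_iff.1 h1, h2⟩⟩

theorem IsFine.append {δ : I → ℝ} {L L' : List (ClosedSubinterval × I)} (h : IsFine δ L)
    (h' : IsFine δ L') : IsFine δ (L ++ L') := fun p hp =>
  (List.mem_append.1 hp).elim (h p) (h' p)

theorem IsPerron.append {L L' : List (ClosedSubinterval × I)} (h : IsPerron L)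
    (h' : IsPerron L') : IsPerron (L ++ L') := fun p hp =>
  (List.mem_append.1 hp).elim (h p) (h' p)

theorem IsFine.mono {δ δ' : I → ℝ} {L : List (ClosedSubinterval × I)} (h : IsFine δ L)
    (hδ : ∀ t, δ t ≤ δ' t) : IsFine δ' L :=
  fun p hp => (h p hp).trans (Metric.ball_subset_ball (hδ _))

theorem IsFine.filter {δ : I → ℝ} {L : List (ClosedSubinterval × I)} (h : IsFine δ L)
    (s : ClosedSubinterval × I → Bool) : IsFine δ (L.filter s) :=
  fun p hp => h p (List.mem_of_mem_filter hp)

theorem IsPerron.filter {L : List (ClosedSubinterval × I)} (h : IsPerron L)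
    (s : ClosedSubinterval × I → Bool) : IsPerron (L.filter s) :=
  fun p hp => h p (List.mem_of_mem_filter hp)

section Sums

variable {Y : Type*} [AddCommGroup Y]

theorem sum_map_filter_of_eq_zero {α : Type*} (L : List α) (s : α → Bool) (φ : α → Y)
    (h : ∀ p ∈ L, s p = false → φ p = 0) : ((L.filter s).map φ).sum = (L.map φ).sum := by
  induction L with
  | nil => rfl
  | cons p L ih =>
    have ih' := ih fun q hq => h q (List.mem_cons_of_mem _ hq)
    cases hs : s p
    · rw [List.filter_cons_of_neg (by simp [hs]), ih', List.map_cons, List.sum_cons,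
        h p List.mem_cons_self hs, zero_add]
    · rw [List.filter_cons_of_pos hs, List.map_cons, List.sum_cons, ih', List.map_cons,
        List.sum_cons]

theorem sum_map_filter {α : Type*} (L : List α) (s : α → Prop) [DecidablePred s] (φ : α → Y) :
    ((L.filter s).map φ).sum = (L.map fun p => if s p then φ p else 0).sum := by
  rw [← sum_map_filter_of_eq_zero L (fun p => decide (s p)) fun p => if s p then φ p else 0]
  · congr 1
    refine List.map_congr_left fun p hp => ?_
    simp [of_decide_eq_true (List.mem_filter.1 hp).2]
  · intro p _ h
    simp [of_decide_eq_false h]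

theorem sum_map_sub {α : Type*} (L : List α) (φ ψ : α → Y) :
    (L.map fun p => φ p - ψ p).sum = (L.map φ).sum - (L.map ψ).sum := by
  induction L with
  | nil => simp
  | cons p L ih => simp only [List.map_cons, List.sum_cons, ih]; abel

/-- Removing the degenerate intervals from a tiling leaves a tiling. -/
theorem Tiles.filter_nondegenerate {a b : I} {L : List (ClosedSubinterval × I)}
    (h : Tiles a b L) : Tiles a b (L.filter fun p => p.1.fst < p.1.snd) :=
  ⟨h.nonOverlapping.filter _, fun p hp => h.bounds p (List.mem_of_mem_filter hp),
    fun x hx hx' => by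
      obtain ⟨p, h1, h2⟩ := h.cover x hx hx'
      exact ⟨p, List.mem_filter.2 ⟨h1, by simpa using h2.1.trans_lt h2.2⟩, h2⟩⟩

theorem sum_increment_aux (F : I → Y) (b : I) (n : ℕ) :
    ∀ (a : I) (L : List (ClosedSubinterval × I)), L.length = n → a ≤ b → Tiles a b L →
      (∀ p ∈ L, p.1.fst < p.1.snd) → (L.map fun p => p.1.increment F).sum = F b - F a := by
  induction n with
  | zero =>
    intro a L hn hab hL _
    obtain rfl := List.length_eq_zero_iff.1 hn
    have : a = b := hab.eq_of_not_lt fun h => by simpa using hL.cover a le_rfl h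
    simp [this]
  | succ n ih =>
    intro a L hn hab hL hnd
    obtain ⟨q, hq⟩ := List.exists_mem_of_length_eq_add_one hn
    have hab' : a < b :=
      ((hL.bounds q hq).1.trans_lt (hnd q hq)).trans_le (hL.bounds q hq).2
    obtain ⟨p, hp, hpa, hpa'⟩ := hL.cover a le_rfl hab'
    have hpa : p.1.fst = a := le_antisymm hpa (hL.bounds p hp).1
    have hperm := List.perm_cons_erase hp
    have hL' := hL.perm hperm
    have hno := List.pairwise_cons.1 hL'.nonOverlapping
    have key : (((L.erase p).map fun p => p.1.increment F).sum) = F b - F p.1.snd := by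
      refine ih _ _ ?_ (hL.bounds p hp).2 ⟨hno.2, fun r hr => ?_, fun x hx hx' => ?_⟩
        fun r hr => hnd r (List.mem_of_mem_erase hr)
      · rw [List.length_erase_of_mem hp, hn]; rfl
      · have hr' := List.mem_of_mem_erase hr
        refine ⟨?_, (hL.bounds r hr').2⟩
        refine ((hno.1 r hr).le_or_le (hnd p hp) (hnd r hr')).resolve_right fun h => ?_
        exact absurd ((hnd r hr').trans_le (h.trans (hpa.le.trans (hL.bounds r hr').1)))
          (lt_irrefl _)
      · obtain ⟨r, hr, h1, h2⟩ := hL'.cover x ((hpa ▸ p.1.fst_le_snd).trans hx) hx'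
        rcases List.mem_cons.1 hr with rfl | hr
        · exact absurd h2 (not_lt.2 hx)
        · exact ⟨r, hr, h1, h2⟩
    rw [(hperm.map _).sum_eq, List.map_cons, List.sum_cons, key, ClosedSubinterval.increment, hpa]
    abel

/-- Increments telescope over a tiling. -/
theorem Tiles.sum_increment {a b : I} {L : List (ClosedSubinterval × I)} (hab : a ≤ b)
    (hL : Tiles a b L) (F : I → Y) : (L.map fun p => p.1.increment F).sum = F b - F a := by
  rw [← sum_increment_aux F b _ a _ rfl hab hL.filter_nondegenerate
    fun p hp => by simpa using (List.mem_filter.1 hp).2]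
  refine (sum_map_filter_of_eq_zero _ _ _ fun p _ h => ?_).symm
  have : p.1.snd = p.1.fst := le_antisymm (by simpa using h) p.1.fst_le_snd
  simp [ClosedSubinterval.increment, this]

end Sums

/-! ### Cousin's lemma and the extension of partial partitions -/

/-- **Cousin's lemma**: every interval has a `δ`-fine Perron partition. -/
theorem exists_tiles {δ : I → ℝ} (hδ : IsGauge δ) {a b : I} (hab : a ≤ b) :
    ∃ L, Tiles a b L ∧ IsPerron L ∧ IsFine δ L := by
  set s : Set I := {x | a ≤ x ∧ x ≤ b ∧ ∃ L, Tiles a x L ∧ IsPerron L ∧ IsFine δ L} with hs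
  have ha : a ∈ s := ⟨le_rfl, hab, [], Tiles.nil a, by simp [IsPerron], by simp [IsFine]⟩
  set c := sSup s with hc
  have hac : a ≤ c := le_sSup ha
  have hcb : c ≤ b := sSup_le fun x hx => hx.2.1
  have step : ∀ x y : I, ∀ hxy : x ≤ y, x ∈ s → y ≤ b → x ≤ c → c ≤ y →
      dist x c < δ c → dist y c < δ c → y ∈ s := by
    rintro x y hxy ⟨hax, _, L, h1, h2, h3⟩ hyb hxc hcy hx hy
    refine ⟨hax.trans hxy, hyb, L ++ [(⟨(x, y), hxy⟩, c)],
      h1.append hax hxy (Tiles.singleton ⟨(x, y), hxy⟩ c), h2.append ?_, h3.append ?_⟩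
    · intro p hp
      obtain rfl := List.mem_singleton.1 hp
      exact ⟨hxc, hcy⟩
    · intro p hp
      obtain rfl := List.mem_singleton.1 hp
      rintro z ⟨hz1, hz2⟩
      have hz1 : (x : ℝ) ≤ z := hz1
      have hz2 : (z : ℝ) ≤ y := hz2
      rw [Subtype.dist_eq, Real.dist_eq, abs_lt] at hx hy
      rw [Metric.mem_ball, Subtype.dist_eq, Real.dist_eq, abs_lt]
      constructor <;> linarith
  have hcs : c ∈ s := by
    obtain ⟨x, hx, hxs⟩ : ∃ x ∈ s, (c : ℝ) - δ c < x := by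
      by_contra! h
      rcases hac.eq_or_lt with h' | h'
      · have := h a ha
        rw [h'] at this
        linarith [hδ c]
      obtain ⟨y, hy, hyc⟩ : ∃ y : I, (c : ℝ) - δ c ≤ y ∧ y < c := by
        refine ⟨⟨max a (c - δ c), le_max_of_le_left a.2.1, max_le a.2.2 ?_⟩, le_max_right _ _, ?_⟩
        · linarith [hδ c, c.2.2]
        · exact Subtype.coe_lt_coe.1 (max_lt h' (by linarith [hδ c]))
      obtain ⟨z, hz, hyz⟩ := lt_sSup_iff.1 hyc
      exact absurd (h z hz) (not_le.2 (hy.trans_lt hyz))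
    have hxc : x ≤ c := le_sSup hx
    refine step x c hxc hx hcb hxc le_rfl ?_ (by simpa using hδ c)
    have : (x : ℝ) ≤ c := hxc
    rw [Subtype.dist_eq, Real.dist_eq, abs_lt]
    constructor <;> linarith [hδ c]
  rcases hcb.eq_or_lt with h | h
  · rw [← h]; exact hcs.2.2
  · exfalso
    obtain ⟨y, hcy, hyb, hy⟩ : ∃ y : I, c < y ∧ y ≤ b ∧ dist y c < δ c := by
      have h' : (c : ℝ) < b := h
      have hd := hδ c
      refine ⟨⟨min b (c + δ c / 2), le_min b.2.1 ?_, min_le_of_left_le b.2.2⟩, ?_, ?_, ?_⟩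
      · linarith [c.2.1]
      · exact Subtype.coe_lt_coe.1 (lt_min h' (by linarith))
      · exact Subtype.coe_le_coe.1 (min_le_left _ _)
      · rw [Subtype.dist_eq, Real.dist_eq, abs_lt]
        constructor
        · show -δ c < min (b : ℝ) (c + δ c / 2) - c
          rw [lt_sub_iff_add_lt]
          exact lt_min (by linarith) (by linarith)
        · show min (b : ℝ) (c + δ c / 2) - c < δ c
          linarith [min_le_right (b : ℝ) (c + δ c / 2)]
    exact absurd (le_sSup (step c y hcy.le hcs hyb le_rfl hcy.le (by simpa using hδ c) hy))
      (not_le.2 hcy)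

section Defect

variable {Y : Type*} [NormedAddCommGroup Y] [NormedSpace ℝ Y]

/-- The defect `F(J) - |J| g(t)` of the tagged interval `(J, t)`. -/
def defect (F g : I → Y) (p : ClosedSubinterval × I) : Y :=
  p.1.increment F - p.1.length • g p.2

theorem defect_eq_zero (F g : I → Y) {p : ClosedSubinterval × I} (hp : p.1.snd ≤ p.1.fst) :
    defect F g p = 0 := by
  have : p.1.snd = p.1.fst := le_antisymm hp p.1.fst_le_snd
  simp [defect, ClosedSubinterval.increment, ClosedSubinterval.length, this]

/-- If every interval has `δ`-fine Perron partitions with arbitrarily small sum of defects, then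
every family of nonoverlapping nondegenerate intervals can be completed to a partition by a
`δ`-fine Perron family with arbitrarily small sum of defects. -/
theorem exists_completion {F g : I → Y} {δ : I → ℝ}
    (H : ∀ a b : I, a ≤ b → ∀ ε > 0, ∃ L, Tiles a b L ∧ IsPerron L ∧ IsFine δ L ∧
      ‖(L.map (defect F g)).sum‖ ≤ ε) (n : ℕ) :
    ∀ (L : List (ClosedSubinterval × I)), L.length ≤ n → ∀ (a b : I), a ≤ b →
      NonOverlapping L → (∀ p ∈ L, p.1.fst < p.1.snd) →
      (∀ p ∈ L, a ≤ p.1.fst ∧ p.1.snd ≤ b) → ∀ ε > 0,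
      ∃ R, Tiles a b (L ++ R) ∧ IsPerron R ∧ IsFine δ R ∧ ‖(R.map (defect F g)).sum‖ ≤ ε := by
  induction n with
  | zero =>
    intro L hn a b hab _ _ _ ε hε
    obtain rfl := List.length_eq_zero_iff.1 (Nat.le_zero.1 hn)
    simpa using H a b hab ε hε
  | succ n ih =>
    rintro (_ | ⟨p, L⟩) hn a b hab hL hnd hb ε hε
    · simpa using H a b hab ε hε
    have hpL := List.pairwise_cons.1 hL
    have hp := hb p List.mem_cons_self
    have hpnd := hnd p List.mem_cons_self
    have hn' : L.length ≤ n := by simpa using hn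
    set Ll := L.filter fun q => q.1.snd ≤ p.1.fst with hLl
    set Lr := L.filter fun q => !decide (q.1.snd ≤ p.1.fst) with hLr
    have hperm : (Ll ++ Lr).Perm L := List.filter_append_perm _ L
    have hmemr : ∀ q ∈ Lr, q ∈ L ∧ p.1.snd ≤ q.1.fst := by
      intro q hq
      have h := List.mem_filter.1 hq
      refine ⟨h.1, ((hpL.1 q h.1).le_or_le hpnd
        (hnd q (List.mem_cons_of_mem _ h.1))).resolve_right ?_⟩
      simpa using h.2
    have hmeml : ∀ q ∈ Ll, q ∈ L ∧ q.1.snd ≤ p.1.fst := by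
      intro q hq
      have h := List.mem_filter.1 hq
      exact ⟨h.1, by simpa using h.2⟩
    obtain ⟨R1, hR1, hR1p, hR1f, hR1s⟩ := ih Ll ((List.length_filter_le _ _).trans hn') a p.1.fst
      hp.1 (NonOverlapping.filter hpL.2 _)
      (fun q hq => hnd q (List.mem_cons_of_mem _ (hmeml q hq).1))
      (fun q hq => ⟨(hb q (List.mem_cons_of_mem _ (hmeml q hq).1)).1, (hmeml q hq).2⟩)
      (ε / 2) (half_pos hε)
    obtain ⟨R2, hR2, hR2p, hR2f, hR2s⟩ := ih Lr ((List.length_filter_le _ _).trans hn') p.1.snd b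
      hp.2 (NonOverlapping.filter hpL.2 _)
      (fun q hq => hnd q (List.mem_cons_of_mem _ (hmemr q hq).1))
      (fun q hq => ⟨(hmemr q hq).2, (hb q (List.mem_cons_of_mem _ (hmemr q hq).1)).2⟩)
      (ε / 2) (half_pos hε)
    refine ⟨R1 ++ R2, ?_, hR1p.append hR2p, hR1f.append hR2f, ?_⟩
    · have h1 := (hR1.append hp.1 p.1.fst_le_snd (Tiles.singleton p.1 p.2)).append
        (hp.1.trans p.1.fst_le_snd) hp.2 hR2
      refine h1.perm (((List.Perm.refl _).append_right _).trans ?_)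
      have h2 : (Ll ++ R1 ++ [(p.1, p.2)] ++ (Lr ++ R2)).Perm (p :: (Ll ++ Lr) ++ (R1 ++ R2)) := by
        classical
        rw [List.perm_iff_count]
        intro q
        simp only [List.count_append, List.count_cons, List.count_nil, Prod.mk.eta]
        omega
      exact h2.trans ((hperm.cons p).append_right _)
    · rw [List.map_append, List.sum_append]
      exact (norm_add_le _ _).trans (by linarith)

/-- A nonoverlapping nondegenerate family can be completed to a partition of `[a, b]` by a
`δ`-fine Perron family. -/
theorem exists_fine_completion {δ : I → ℝ} (hδ : IsGauge δ) {a b : I} (hab : a ≤ b)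
    {L : List (ClosedSubinterval × I)} (hL : NonOverlapping L)
    (hnd : ∀ p ∈ L, p.1.fst < p.1.snd) (hb : ∀ p ∈ L, a ≤ p.1.fst ∧ p.1.snd ≤ b) :
    ∃ R, Tiles a b (L ++ R) ∧ IsPerron R ∧ IsFine δ R := by
  obtain ⟨R, h1, h2, h3, _⟩ := exists_completion (F := fun _ => (0 : ℝ)) (g := fun _ => 0) (δ := δ)
    (fun a b hab ε hε => by
      obtain ⟨L, h1, h2, h3⟩ := exists_tiles hδ hab
      refine ⟨L, h1, h2, h3, ?_⟩
      have : (defect (fun _ => (0 : ℝ)) fun _ => 0) = fun _ => 0 := by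
        funext p; simp [defect, ClosedSubinterval.increment]
      rw [this]
      simpa using hε.le) _ L le_rfl a b hab hL hnd hb 1 one_pos
  exact ⟨R, h1, h2, h3⟩

end Defect

end TaggedList

/-! ### Tiles and partitions of the unit interval -/

namespace TaggedList

theorem coe_subset_of_snd_le_fst {J : ClosedSubinterval} {t : I} {r : ℝ} (hJ : J.snd ≤ J.fst)
    (ht : t = J.fst) (hr : 0 < r) : (J : Set I) ⊆ Metric.ball t r := by
  rintro x ⟨h1, h2⟩
  have : x = t := ht ▸ le_antisymm (h2.trans hJ) h1
  rw [this]
  exact Metric.mem_ball_self hr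

theorem NonOverlapping.of_mem_of_ne {L : List (ClosedSubinterval × I)} (hL : NonOverlapping L)
    {p q : ClosedSubinterval × I} (hp : p ∈ L) (hq : q ∈ L) (hpq : p ≠ q) :
    p.1.NonOverlapping q.1 := by
  have h : L.Pairwise fun p q => p ≠ q → p.1.NonOverlapping q.1 :=
    List.Pairwise.imp (fun {_ _} h => fun _ => h) hL
  have h' : L.Pairwise fun p q => q ≠ p → q.1.NonOverlapping p.1 :=
    List.Pairwise.imp (fun {_ _} h => fun _ => h.symm) hL
  exact List.Pairwise.forall_of_forall_of_flip (fun _ _ h => absurd rfl h) h h' hp hq hpq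

/-- Repeated elements of a nonoverlapping list are degenerate, so that sums over the list and
over the corresponding finite set agree. -/
theorem NonOverlapping.sum_toFinset [DecidableEq (ClosedSubinterval × I)] {M : Type*}
    [AddCommMonoid M] {L : List (ClosedSubinterval × I)}
    (hL : NonOverlapping L) (φ : ClosedSubinterval × I → M)
    (hφ : ∀ p, p.1.snd ≤ p.1.fst → φ p = 0) : ∑ p ∈ L.toFinset, φ p = (L.map φ).sum := by
  induction L with
  | nil => simp
  | cons p L ih =>
    have h := List.pairwise_cons.1 hL
    rw [List.toFinset_cons, List.map_cons, List.sum_cons, ← ih h.2]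
    by_cases hp : p ∈ L
    · rw [Finset.insert_eq_of_mem (List.mem_toFinset.2 hp), hφ p, zero_add]
      by_contra! hlt
      obtain ⟨x, hx⟩ := exists_between hlt
      exact Set.disjoint_left.1 (h.1 p hp) hx hx
    · rw [Finset.sum_insert (mt List.mem_toFinset.1 hp)]

/-- The degenerate tagged interval at the right end point of `[0,1]`. Adding it turns a half-open
cover into a cover. -/
def rightEnd : ClosedSubinterval × I := (⟨(1, 1), le_rfl⟩, 1)

theorem Tiles.isPartitionOf [DecidableEq (ClosedSubinterval × I)]
    {L : List (ClosedSubinterval × I)} (hL : Tiles 0 1 L) :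
    TaggedFamily.IsPartitionOf (rightEnd :: L).toFinset := by
  refine ⟨fun p hp q hq hpq => ?_, eq_univ_of_forall fun x => ?_⟩
  · rw [List.mem_toFinset] at hp hq
    refine NonOverlapping.of_mem_of_ne (L := rightEnd :: L) ?_ hp hq hpq
    exact List.pairwise_cons.2
      ⟨fun r _ => ClosedSubinterval.nonOverlapping_of_snd_le_fst le_rfl, hL.nonOverlapping⟩
  · simp only [mem_iUnion]
    rcases (unitInterval.le_one' (t := x)).eq_or_lt with h | h
    · exact ⟨rightEnd, by simp, h.ge, h.le⟩
    · obtain ⟨p, hp, h1, h2⟩ := hL.cover x unitInterval.nonneg' h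
      exact ⟨p, by simp [hp], h1, h2.le⟩

theorem IsFine.rightEnd_cons {δ : I → ℝ} (hδ : IsGauge δ) {L : List (ClosedSubinterval × I)}
    (hL : IsFine δ L) : IsFine δ (rightEnd :: L) := by
  intro p hp
  rcases List.mem_cons.1 hp with rfl | hp
  · exact coe_subset_of_snd_le_fst le_rfl rfl (hδ _)
  · exact hL p hp

theorem IsPerron.rightEnd_cons {L : List (ClosedSubinterval × I)}
    (hL : IsPerron L) : IsPerron (rightEnd :: L) := by
  intro p hp
  rcases List.mem_cons.1 hp with rfl | hp
  · exact ⟨le_rfl, le_rfl⟩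
  · exact hL p hp

theorem NonOverlapping.rightEnd_cons {L : List (ClosedSubinterval × I)}
    (hL : NonOverlapping L) : NonOverlapping (rightEnd :: L) :=
  List.pairwise_cons.2 ⟨fun _ _ => ClosedSubinterval.nonOverlapping_of_snd_le_fst le_rfl, hL⟩

theorem nonOverlapping_toList {P : TaggedFamily} (hP : P.IsPartitionIn) :
    NonOverlapping P.toList := by
  refine List.Nodup.pairwise_of_forall_ne P.nodup_toList fun p hp q hq hpq => ?_
  exact hP p (Finset.mem_toList.1 hp) q (Finset.mem_toList.1 hq) hpq

/-- A finite family of closed intervals that covers `[a, b]` covers `[a, b)` by the half-open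
intervals. -/
theorem exists_mem_Ico_of_cover {L : List (ClosedSubinterval × I)} {a b : I}
    (hL : ∀ x, a ≤ x → x ≤ b → ∃ p ∈ L, x ∈ (p.1 : Set I)) {x : I} (hax : a ≤ x) (hxb : x < b) :
    ∃ p ∈ L, p.1.fst ≤ x ∧ x < p.1.snd := by
  have hcl : x ∈ closure (⋃ p ∈ {p | p ∈ L}, (p.1 : Set I) ∩ Ioc x b) := by
    have : x ∈ closure (Ioc x b) := by
      rw [closure_Ioc hxb.ne]
      exact left_mem_Icc.2 hxb.le
    refine closure_mono (fun y hy => ?_) this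
    obtain ⟨p, hp, hy'⟩ := hL y (hax.trans hy.1.le) hy.2
    exact mem_iUnion₂.2 ⟨p, hp, hy', hy⟩
  rw [(List.finite_toSet L).closure_biUnion] at hcl
  obtain ⟨p, hp, hx⟩ := mem_iUnion₂.1 hcl
  refine ⟨p, hp, ?_, ?_⟩
  · have : closure ((p.1 : Set I) ∩ Ioc x b) ⊆ Icc p.1.fst p.1.snd :=
      closure_minimal inter_subset_left isClosed_Icc
    exact (this hx).1
  · obtain ⟨y, hy, hy'⟩ := closure_nonempty_iff.1 ⟨x, hx⟩
    exact hy'.1.trans_le hy.2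

theorem tiles_toList {P : TaggedFamily} (hP : P.IsPartitionOf) : Tiles 0 1 P.toList := by
  refine ⟨nonOverlapping_toList hP.1, fun p _ => ⟨unitInterval.nonneg', unitInterval.le_one'⟩,
    fun x hx hx' => exists_mem_Ico_of_cover (fun y _ _ => ?_) hx hx'⟩
  have : y ∈ ⋃ p ∈ P, (p.1 : Set I) := hP.2 ▸ mem_univ y
  obtain ⟨p, hp, hy⟩ := mem_iUnion₂.1 this
  exact ⟨p, Finset.mem_toList.2 hp, hy⟩

/-! ### Measure estimates for nonoverlapping families -/

theorem NonOverlapping.sum_measure_le (ν : Measure I) {L : List (ClosedSubinterval × I)}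
    (hL : NonOverlapping L) {U : Set I} (hU : ∀ p ∈ L, Ioo p.1.fst p.1.snd ⊆ U) :
    (L.map fun p => ν (Ioo p.1.fst p.1.snd)).sum ≤ ν U := by
  suffices h : (L.map fun p => ν (Ioo p.1.fst p.1.snd)).sum =
      ν (⋃ p ∈ {p | p ∈ L}, Ioo p.1.fst p.1.snd) from
    h ▸ measure_mono (iUnion₂_subset hU)
  clear hU
  induction L with
  | nil => simp
  | cons p L ih =>
    have h := List.pairwise_cons.1 hL
    have hset : {q | q ∈ p :: L} = insert p {q | q ∈ L} := by ext; simp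
    rw [List.map_cons, List.sum_cons, ih h.2, hset, biUnion_insert, measure_union]
    · exact disjoint_iUnion₂_right.2 h.1
    · exact (isOpen_biUnion fun _ _ => isOpen_Ioo).measurableSet

theorem NonOverlapping.sum_length_le {L : List (ClosedSubinterval × I)}
    (hL : NonOverlapping L) {U : Set I} (hU : ∀ p ∈ L, Ioo p.1.fst p.1.snd ⊆ U) :
    (L.map fun p => p.1.length).sum ≤ volume.real U := by
  have h := hL.sum_measure_le volume hU
  have h2 : ENNReal.ofReal (L.map fun p => p.1.length).sum =
      (L.map fun p => (volume : Measure I) (Ioo p.1.fst p.1.snd)).sum := by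
    clear h hU hL
    induction L with
    | nil => simp
    | cons p L ih =>
      rw [List.map_cons, List.sum_cons, List.map_cons, List.sum_cons, ← ih,
        ENNReal.ofReal_add p.1.length_nonneg, unitInterval.volume_Ioo]
      · rfl
      · refine List.sum_nonneg fun x hx => ?_
        obtain ⟨q, _, rfl⟩ := List.mem_map.1 hx
        exact q.1.length_nonneg
  rw [← h2] at h
  exact (ENNReal.ofReal_le_iff_le_toReal (measure_ne_top _ _)).1 h

theorem NonOverlapping.sum_length_le_one {L : List (ClosedSubinterval × I)}
    (hL : NonOverlapping L) : (L.map fun p => p.1.length).sum ≤ 1 := by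
  simpa using hL.sum_length_le (U := univ) fun _ _ => subset_univ _

/-- A function that vanishes off a null set has arbitrarily small absolute Riemann sums, with
arbitrary tags. -/
theorem exists_gauge_sum_le_of_null {N : Set I} (hN : volume N = 0) (w : I → ℝ) {ε : ℝ}
    (hε : 0 < ε) : ∃ δ : I → ℝ, IsGauge δ ∧ ∀ L, NonOverlapping L → IsFine δ L →
      (∀ p ∈ L, p.2 ∈ N) → (L.map fun p => p.1.length * w p.2).sum ≤ ε := by
  obtain ⟨ε', hε', hsum⟩ := ENNReal.exists_pos_sum_of_countable
    (ENNReal.ofReal_pos.2 hε).ne' ℕ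
  have hU : ∀ n : ℕ, ∃ U ⊇ N, IsOpen U ∧ volume U < ε' n / (n + 1) := fun n => by
    refine N.exists_isOpen_lt_of_lt _ ?_
    rw [hN]
    exact ENNReal.div_pos (by simpa using (hε' n).ne') (by finiteness)
  choose U hNU hUo hUv using hU
  -- The measure with density `∑ n · 1_{U n}` has small mass, and bounds each `|J| w(t)`.
  set h : I → ℝ≥0∞ := fun x => ∑' n : ℕ, (U n).indicator (fun _ => (n : ℝ≥0∞)) x with hh
  set ν : Measure I := volume.withDensity h with hν
  have hνu : ν univ ≤ ENNReal.ofReal ε := by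
    rw [hν, withDensity_apply _ MeasurableSet.univ, Measure.restrict_univ, hh,
      lintegral_tsum fun n => (measurable_const.indicator (hUo n).measurableSet).aemeasurable]
    refine le_trans (ENNReal.tsum_le_tsum fun n => ?_) hsum.le
    rw [lintegral_indicator_const (hUo n).measurableSet]
    calc (n : ℝ≥0∞) * volume (U n) ≤ (n + 1) * (ε' n / (n + 1)) := by
          gcongr
          · exact le_self_add
          · exact (hUv n).le
      _ ≤ ε' n := ENNReal.mul_div_le
  have hball : ∀ t, ∃ r > 0, t ∈ N → Metric.ball t r ⊆ U ⌈w t⌉₊ := fun t => by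
    by_cases ht : t ∈ N
    · obtain ⟨r, hr, h⟩ := Metric.isOpen_iff.1 (hUo ⌈w t⌉₊) t (hNU _ ht)
      exact ⟨r, hr, fun _ => h⟩
    · exact ⟨1, one_pos, fun h => absurd h ht⟩
  choose δ hδ hδU using hball
  refine ⟨δ, hδ, fun L hL hLf hLN => ?_⟩
  have h1 : ENNReal.ofReal (L.map fun p => p.1.length * w p.2).sum ≤
      (L.map fun p => ν (Ioo p.1.fst p.1.snd)).sum := by
    clear hL
    induction L with
    | nil => simp
    | cons p L ih =>
      rw [List.map_cons, List.sum_cons, List.map_cons, List.sum_cons]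
      refine ENNReal.ofReal_add_le.trans (add_le_add ?_ (ih
        (fun q hq => hLf q (List.mem_cons_of_mem _ hq))
        fun q hq => hLN q (List.mem_cons_of_mem _ hq)))
      have hsub : Ioo p.1.fst p.1.snd ⊆ U ⌈w p.2⌉₊ :=
        (Ioo_subset_Icc_self.trans (hLf p List.mem_cons_self)).trans
          (hδU _ (hLN p List.mem_cons_self))
      rw [hν, withDensity_apply _ measurableSet_Ioo]
      calc ENNReal.ofReal (p.1.length * w p.2)
          ≤ ENNReal.ofReal (p.1.length * ⌈w p.2⌉₊) :=
            ENNReal.ofReal_le_ofReal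
              (mul_le_mul_of_nonneg_left (Nat.le_ceil _) p.1.length_nonneg)
        _ = ∫⁻ _ in Ioo p.1.fst p.1.snd, (⌈w p.2⌉₊ : ℝ≥0∞) := by
            rw [setLIntegral_const, unitInterval.volume_Ioo, mul_comm,
              ENNReal.ofReal_mul (Nat.cast_nonneg _), ENNReal.ofReal_natCast]
            rfl
        _ ≤ _ := by
            refine setLIntegral_mono_ae' measurableSet_Ioo (ae_of_all _ fun x hx => ?_)
            refine le_trans ?_ (ENNReal.le_tsum ⌈w p.2⌉₊)
            rw [indicator_of_mem (hsub hx)]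
  have h2 := (h1.trans (hL.sum_measure_le ν (U := univ) fun _ _ => subset_univ _)).trans hνu
  exact (ENNReal.ofReal_le_ofReal_iff hε.le).1 h2

end TaggedList

/-! ### The McShane integral of a function with values in a Banach space -/

namespace TaggedList

section McShane

variable {Y : Type*} [NormedAddCommGroup Y] [NormedSpace ℝ Y]

/-- The Riemann sum `∑ |J| g(t)` over the tagged intervals `(J, t)` of the list `L`. -/
def riemannSum (g : I → Y) (L : List (ClosedSubinterval × I)) : Y :=
  (L.map fun p => p.1.length • g p.2).sum

theorem riemannSum_append (g : I → Y) (L L' : List (ClosedSubinterval × I)) :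
    riemannSum g (L ++ L') = riemannSum g L + riemannSum g L' := by
  simp [riemannSum]

theorem sum_defect (F g : I → Y) (L : List (ClosedSubinterval × I)) :
    (L.map (defect F g)).sum = (L.map fun p => p.1.increment F).sum - riemannSum g L :=
  sum_map_sub L _ _

theorem norm_sum_map_le {α E : Type*} [SeminormedAddCommGroup E] (L : List α) (φ : α → E) :
    ‖(L.map φ).sum‖ ≤ (L.map fun p => ‖φ p‖).sum := by
  induction L with
  | nil => simp
  | cons p L ih =>
    simp only [List.map_cons, List.sum_cons]
    exact (norm_add_le _ _).trans (add_le_add_right ih _)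

/-- The Riemann sums of `g` over the fine McShane partitions of `[0,1]` are Cauchy. -/
def RiemannCauchy (g : I → Y) : Prop :=
  ∀ ε > 0, ∃ δ : I → ℝ, IsGauge δ ∧ ∀ L L', Tiles 0 1 L → Tiles 0 1 L' →
    IsFine δ L → IsFine δ L' → ‖riemannSum g L - riemannSum g L'‖ ≤ ε

/-- `y` is the limit of the Riemann sums of `g` over the fine McShane partitions of `[a, b]`. -/
def HasMcShaneIntegral (g : I → Y) (a b : I) (y : Y) : Prop :=
  ∀ ε > 0, ∃ δ : I → ℝ, IsGauge δ ∧ ∀ L, Tiles a b L → IsFine δ L → ‖riemannSum g L - y‖ ≤ ε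

theorem isGauge_min {δ δ' : I → ℝ} (h : IsGauge δ) (h' : IsGauge δ') :
    IsGauge fun t => min (δ t) (δ' t) :=
  fun t => lt_min (h t) (h' t)

theorem HasMcShaneIntegral.add {g : I → Y} {a b c : I} {y z w : Y} (hab : a ≤ b) (hbc : b ≤ c)
    (hy : HasMcShaneIntegral g a b y) (hz : HasMcShaneIntegral g b c z)
    (hw : HasMcShaneIntegral g a c w) : w = y + z := by
  refine eq_of_forall_dist_le fun ε hε => ?_
  have hε3 : 0 < ε / 3 := by positivity
  obtain ⟨δ1, hδ1, h1⟩ := hy _ hε3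
  obtain ⟨δ2, hδ2, h2⟩ := hz _ hε3
  obtain ⟨δ3, hδ3, h3⟩ := hw _ hε3
  have hδ := isGauge_min hδ3 (isGauge_min hδ1 hδ2)
  obtain ⟨L, hL, -, hLf⟩ := exists_tiles hδ hab
  obtain ⟨L', hL', -, hLf'⟩ := exists_tiles hδ hbc
  have e1 := h1 L hL (hLf.mono fun t => (min_le_right _ _).trans (min_le_left _ _))
  have e2 := h2 L' hL' (hLf'.mono fun t => (min_le_right _ _).trans (min_le_right _ _))
  have e3 := h3 _ (hL.append hab hbc hL') ((hLf.append hLf').mono fun t => min_le_left _ _)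
  rw [riemannSum_append] at e3
  rw [dist_eq_norm]
  calc ‖w - (y + z)‖ = ‖(riemannSum g L - y) + (riemannSum g L' - z) -
        (riemannSum g L + riemannSum g L' - w)‖ := by congr 1; abel
    _ ≤ ‖riemannSum g L - y‖ + ‖riemannSum g L' - z‖ +
        ‖riemannSum g L + riemannSum g L' - w‖ :=
        (norm_sub_le _ _).trans (add_le_add_left (norm_add_le _ _) _)
    _ ≤ ε := by linarith

theorem HasMcShaneIntegral.unique {g : I → Y} {a b : I} {y z : Y} (hab : a ≤ b)
    (hy : HasMcShaneIntegral g a b y) (hz : HasMcShaneIntegral g a b z) : y = z := by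
  refine eq_of_forall_dist_le fun ε hε => ?_
  obtain ⟨δ1, hδ1, h1⟩ := hy _ (half_pos hε)
  obtain ⟨δ2, hδ2, h2⟩ := hz _ (half_pos hε)
  obtain ⟨L, hL, -, hLf⟩ := exists_tiles (isGauge_min hδ1 hδ2) hab
  have e1 := h1 L hL (hLf.mono fun t => min_le_left _ _)
  have e2 := h2 L hL (hLf.mono fun t => min_le_right _ _)
  rw [← dist_eq_norm] at e1 e2
  linarith [dist_triangle_left y z (riemannSum g L)]

/-- Restriction of the Cauchy condition to subintervals: partitions of `[a, b]` are extended to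
`[0,1]` by a common family. -/
theorem RiemannCauchy.exists_hasMcShaneIntegral [CompleteSpace Y] {g : I → Y}
    (hg : RiemannCauchy g) {a b : I} (hab : a ≤ b) : ∃ y, HasMcShaneIntegral g a b y := by
  have hloc : ∀ ε > 0, ∃ δ : I → ℝ, IsGauge δ ∧ ∀ L L', Tiles a b L → Tiles a b L' →
      IsFine δ L → IsFine δ L' → ‖riemannSum g L - riemannSum g L'‖ ≤ ε := by
    intro ε hε
    obtain ⟨δ, hδ, h⟩ := hg ε hε
    obtain ⟨A, hA, -, hAf⟩ := exists_tiles hδ (unitInterval.nonneg' (t := a))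
    obtain ⟨B, hB, -, hBf⟩ := exists_tiles hδ (unitInterval.le_one' (t := b))
    refine ⟨δ, hδ, fun L L' hL hL' hLf hLf' => ?_⟩
    have hext : ∀ M, Tiles a b M → Tiles 0 1 (A ++ M ++ B) := fun M hM =>
      (hA.append unitInterval.nonneg' hab hM).append unitInterval.nonneg' unitInterval.le_one' hB
    have := h _ _ (hext L hL) (hext L' hL') ((hAf.append hLf).append hBf)
      ((hAf.append hLf').append hBf)
    simpa only [riemannSum_append, add_sub_add_right_eq_sub, add_sub_add_left_eq_sub] using this
  choose! δ hδ h using hloc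
  have hpos : ∀ n : ℕ, 0 < 1 / ((n : ℝ) + 1) := fun n => by positivity
  choose L hL _ hLf using fun n : ℕ => exists_tiles (hδ _ (hpos n)) hab
  have hcomp : ∀ ε > 0, ∀ n : ℕ, ∀ M, Tiles a b M → IsFine (δ ε) M →
      ‖riemannSum g M - riemannSum g (L n)‖ ≤ ε + 1 / ((n : ℝ) + 1) := by
    intro ε hε n M hM hMf
    obtain ⟨K, hK, -, hKf⟩ := exists_tiles (isGauge_min (hδ ε hε) (hδ _ (hpos n))) hab
    have e1 := h ε hε M K hM hK hMf (hKf.mono fun t => min_le_left _ _)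
    have e2 := h _ (hpos n) K (L n) hK (hL n) (hKf.mono fun t => min_le_right _ _) (hLf n)
    exact (norm_sub_le_norm_sub_add_norm_sub _ (riemannSum g K) _).trans (add_le_add e1 e2)
  have hlim : Tendsto (fun n : ℕ => 1 / ((n : ℝ) + 1)) atTop (𝓝 0) :=
    tendsto_one_div_add_atTop_nhds_zero_nat
  have hcau : CauchySeq fun n => riemannSum g (L n) := by
    refine cauchySeq_of_le_tendsto_0 (fun n : ℕ => 2 * (1 / ((n : ℝ) + 1))) ?_
      (by simpa using hlim.const_mul 2)
    intro n m N hn hm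
    rw [dist_eq_norm]
    have h1 := Nat.one_div_le_one_div (α := ℝ) hn
    have h2 := Nat.one_div_le_one_div (α := ℝ) hm
    exact (hcomp _ (hpos n) m _ (hL n) (hLf n)).trans (by linarith)
  obtain ⟨y, hy⟩ := cauchySeq_tendsto_of_complete hcau
  refine ⟨y, fun ε hε => ⟨δ ε, hδ ε hε, fun M hM hMf => ?_⟩⟩
  have hlim' : Tendsto (fun n : ℕ => ε + 1 / ((n : ℝ) + 1)) atTop (𝓝 ε) := by
    simpa using hlim.const_add ε
  exact le_of_tendsto_of_tendsto' (hy.const_sub _).norm hlim' fun n => hcomp ε hε n M hM hMf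

/-- A point function `F` whose increments are the integrals of `g` over all intervals. -/
theorem RiemannCauchy.exists_primitive [CompleteSpace Y] {g : I → Y} (hg : RiemannCauchy g) :
    ∃ F : I → Y, ∀ a b, a ≤ b → HasMcShaneIntegral g a b (F b - F a) := by
  choose F hF using fun t : I => hg.exists_hasMcShaneIntegral (unitInterval.nonneg' (t := t))
  refine ⟨F, fun a b hab => ?_⟩
  obtain ⟨y, hy⟩ := hg.exists_hasMcShaneIntegral hab
  rwa [(hF a).add unitInterval.nonneg' hab hy (hF b), add_sub_cancel_left]

/-- The conclusion of the Saks–Henstock lemma: the defects of `F` and `g` have small sum over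
every fine family of nonoverlapping intervals, with arbitrary tags. -/
def SaksHenstock (F g : I → Y) : Prop :=
  ∀ ε > 0, ∃ δ : I → ℝ, IsGauge δ ∧ ∀ L, NonOverlapping L → IsFine δ L →
    ‖(L.map (defect F g)).sum‖ ≤ ε

/-- **Saks–Henstock lemma**. -/
theorem saksHenstock {F g : I → Y} (hF : ∀ a b, a ≤ b → HasMcShaneIntegral g a b (F b - F a)) :
    SaksHenstock F g := by
  intro ε hε
  obtain ⟨δ, hδ, h⟩ := hF 0 1 zero_le_one (ε / 2) (half_pos hε)
  refine ⟨δ, hδ, fun L hL hLf => ?_⟩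
  have H : ∀ a b : I, a ≤ b → ∀ ε > 0, ∃ L, Tiles a b L ∧ IsPerron L ∧ IsFine δ L ∧
      ‖(L.map (defect F g)).sum‖ ≤ ε := by
    intro a b hab ε hε
    obtain ⟨δ', hδ', h'⟩ := hF a b hab ε hε
    obtain ⟨M, hM, hMp, hMf⟩ := exists_tiles (isGauge_min hδ hδ') hab
    refine ⟨M, hM, hMp, hMf.mono fun t => min_le_left _ _, ?_⟩
    rw [sum_defect, hM.sum_increment hab, norm_sub_rev]
    exact h' M hM (hMf.mono fun t => min_le_right _ _)
  set L' := L.filter fun p => p.1.fst < p.1.snd with hL'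
  have hsum : (L'.map (defect F g)).sum = (L.map (defect F g)).sum :=
    sum_map_filter_of_eq_zero _ _ _ fun p _ hp => defect_eq_zero F g (by simpa using hp)
  obtain ⟨R, hR, -, hRf, hRs⟩ := exists_completion H _ L' le_rfl 0 1 zero_le_one (hL.filter _)
    (fun p hp => by simpa using (List.mem_filter.1 hp).2)
    (fun p _ => ⟨unitInterval.nonneg', unitInterval.le_one'⟩) (ε / 2) (half_pos hε)
  have h1 := h _ hR ((hLf.filter _).append hRf)
  rw [norm_sub_rev, ← hR.sum_increment zero_le_one, ← sum_defect, List.map_append,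
    List.sum_append, hsum] at h1
  calc ‖(L.map (defect F g)).sum‖
      = ‖((L.map (defect F g)).sum + (R.map (defect F g)).sum) - (R.map (defect F g)).sum‖ := by
        rw [add_sub_cancel_right]
    _ ≤ ε := (norm_sub_le _ _).trans (by linarith)

/-- The interval `J` clamped to `[a, b]`: it is `J ∩ [a, b]` if this is nonempty, and a degenerate
interval otherwise. -/
def clip (a b : I) (J : ClosedSubinterval) : ClosedSubinterval :=
  ⟨(max a (min J.fst b), max a (min J.snd b)),
    max_le_max le_rfl (min_le_min J.fst_le_snd le_rfl)⟩

theorem clip_subset {a b : I} {J : ClosedSubinterval} (hb : J.fst ≤ b) (ha : a ≤ J.snd) :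
    J.fst ≤ (clip a b J).fst ∧ (clip a b J).snd ≤ J.snd :=
  ⟨le_max_of_le_right (le_min le_rfl hb), max_le ha (min_le_left _ _)⟩

theorem Ioo_clip_subset {a b : I} (J : ClosedSubinterval) :
    Ioo (clip a b J).fst (clip a b J).snd ⊆ Ioo J.fst J.snd := by
  rintro x ⟨h1, h2⟩
  have h1' : max a (min J.fst b) < x := h1
  have h2' : x < max a (min J.snd b) := h2
  have hax : a < x := (le_max_left _ _).trans_lt h1'
  have h3 : x < min J.snd b := (lt_max_iff.1 h2').resolve_left hax.le.not_gt
  refine ⟨?_, h3.trans_le (min_le_left _ _)⟩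
  have h4 := (max_lt_iff.1 h1').2
  exact (min_lt_iff.1 h4).resolve_right (h3.trans_le (min_le_right _ _)).le.not_gt

theorem clip_degenerate {a b : I} {J : ClosedSubinterval}
    (h : ¬ (J.fst ≤ b ∧ a ≤ J.snd)) : (clip a b J).fst = (clip a b J).snd := by
  show max a (min J.fst b) = max a (min J.snd b)
  rcases not_and_or.1 h with h | h
  · rw [min_eq_right (not_le.1 h).le, min_eq_right ((not_le.1 h).le.trans J.fst_le_snd)]
  · have h1 := (not_le.1 h).le
    rw [max_eq_left ((min_le_left _ _).trans h1),
      max_eq_left ((min_le_left _ _).trans (J.fst_le_snd.trans h1))]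

theorem length_clip_le {a b : I} (J : ClosedSubinterval) :
    (clip a b J).length ≤ J.length := by
  by_cases h : J.fst ≤ b ∧ a ≤ J.snd
  · have h1 : ((J.fst : I) : ℝ) ≤ (clip a b J).fst := (clip_subset h.1 h.2).1
    have h2 : (((clip a b J).snd : I) : ℝ) ≤ J.snd := (clip_subset h.1 h.2).2
    exact sub_le_sub h2 h1
  · have : (clip a b J).length = 0 := by
      rw [ClosedSubinterval.length, clip_degenerate h, sub_self]
    rw [this]
    exact J.length_nonneg

theorem clip_eq_self {a b : I} {J : ClosedSubinterval} (ha : a ≤ J.fst) (hb : J.snd ≤ b) :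
    clip a b J = J := by
  have h1 : max a (min J.fst b) = J.fst := by
    rw [min_eq_left (J.fst_le_snd.trans hb), max_eq_right ha]
  have h2 : max a (min J.snd b) = J.snd := by
    rw [min_eq_left hb, max_eq_right (ha.trans J.fst_le_snd)]
  exact NonemptyInterval.toProd_injective (Prod.ext h1 h2)

/-- The integral over `[a, b]` is the integral over `[0,1]` of the function cut off outside of
`[a, b]`. Intervals with a tag in `[a, b]` are clamped to `[a, b]`; this only affects the tags `a`
and `b`, which form a null set. -/
theorem SaksHenstock.hasMcShaneIntegral_indicator {F g : I → Y} (h : SaksHenstock F g) {a b : I}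
    (hab : a ≤ b) : HasMcShaneIntegral ((Icc a b).indicator g) 0 1 (F b - F a) := by
  classical
  intro ε hε
  obtain ⟨δ1, hδ1, h1⟩ := h (ε / 2) (half_pos hε)
  obtain ⟨δ2, hδ2, h2⟩ := exists_gauge_sum_le_of_null (N := {a, b})
    ((Set.toFinite _).measure_zero _) (fun t => ‖g t‖) (half_pos hε)
  have hloc : ∀ t : I, ∃ r > 0, (t ∈ Ioo a b → Metric.ball t r ⊆ Ioo a b) ∧
      (t ∉ Icc a b → Metric.ball t r ⊆ (Icc a b)ᶜ) := by
    intro t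
    by_cases ht : t ∈ Ioo a b
    · obtain ⟨r, hr, h⟩ := Metric.isOpen_iff.1 isOpen_Ioo t ht
      exact ⟨r, hr, fun _ => h, fun h' => absurd (Ioo_subset_Icc_self ht) h'⟩
    · by_cases ht' : t ∈ Icc a b
      · exact ⟨1, one_pos, fun h => absurd h ht, fun h => absurd ht' h⟩
      · obtain ⟨r, hr, h⟩ := Metric.isOpen_iff.1 isClosed_Icc.isOpen_compl t ht'
        exact ⟨r, hr, fun h' => absurd h' ht, fun _ => h⟩
  choose δ3 hδ3 h3 h4 using hloc
  refine ⟨_, isGauge_min hδ1 (isGauge_min hδ2 hδ3), fun L hL hLf => ?_⟩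
  have hf1 : IsFine δ1 L := hLf.mono fun t => min_le_left _ _
  have hf2 : IsFine δ2 L := hLf.mono fun t => (min_le_right _ _).trans (min_le_left _ _)
  have hf3 : IsFine δ3 L := hLf.mono fun t => (min_le_right _ _).trans (min_le_right _ _)
  set κ : I → I := fun x => max a (min x b) with hκ
  set s : ClosedSubinterval × I → Prop :=
    fun p => p.2 ∈ Icc a b ∧ p.1.fst ≤ b ∧ a ≤ p.1.snd with hs
  set c : ClosedSubinterval × I → ClosedSubinterval × I := fun p => (clip a b p.1, p.2) with hc
  have hpt : ∀ p ∈ L, p.1.increment (F ∘ κ) - p.1.length • (Icc a b).indicator g p.2 =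
      (if s p then defect F g (c p) else 0) -
        (if p.2 ∈ ({a, b} : Set I) then (p.1.length - (clip a b p.1).length) • g p.2 else 0) := by
    intro p hp
    have hinc : p.1.increment (F ∘ κ) = (clip a b p.1).increment F := rfl
    rw [hinc]
    by_cases ht : p.2 ∈ Icc a b
    · rw [indicator_of_mem ht]
      have e2 : (if p.2 ∈ ({a, b} : Set I) then
          (p.1.length - (clip a b p.1).length) • g p.2 else 0) =
          (p.1.length - (clip a b p.1).length) • g p.2 := by
        split_ifs with hN
        · rfl
        · have ht' : p.2 ∈ Ioo a b := by
            simp only [mem_insert_iff, mem_singleton_iff, not_or] at hN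
            exact ⟨lt_of_le_of_ne ht.1 (Ne.symm hN.1), lt_of_le_of_ne ht.2 hN.2⟩
          have hsub := (hf3 p hp).trans (h3 _ ht')
          have hl := hsub (show p.1.fst ∈ (p.1 : Set I) from ⟨le_rfl, p.1.fst_le_snd⟩)
          have hr := hsub (show p.1.snd ∈ (p.1 : Set I) from ⟨p.1.fst_le_snd, le_rfl⟩)
          rw [clip_eq_self hl.1.le hr.2.le, sub_self, zero_smul]
      rw [e2]
      by_cases hJ : p.1.fst ≤ b ∧ a ≤ p.1.snd
      · rw [if_pos ⟨ht, hJ⟩, defect, sub_smul]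
        abel
      · rw [if_neg fun h => hJ h.2]
        have e := clip_degenerate hJ
        simp [ClosedSubinterval.increment, ClosedSubinterval.length, e]
    · rw [indicator_of_notMem ht, if_neg fun h => ht h.1, if_neg]
      · have : ¬ (p.1.fst ≤ b ∧ a ≤ p.1.snd) := by
          rintro ⟨hJ1, hJ2⟩
          have hx : max a p.1.fst ∈ (p.1 : Set I) := ⟨le_max_right _ _, max_le hJ2 p.1.fst_le_snd⟩
          exact h4 _ ht (hf3 p hp hx) ⟨le_max_left _ _, max_le hab hJ1⟩
        simp [ClosedSubinterval.increment, clip_degenerate this]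
      · rintro (h | h)
        · exact ht (h.symm ▸ left_mem_Icc.2 hab)
        · exact ht (h.symm ▸ right_mem_Icc.2 hab)
  have hsum : F b - F a - riemannSum ((Icc a b).indicator g) L =
      (((L.filter s).map c).map (defect F g)).sum -
        ((L.filter fun p => p.2 ∈ ({a, b} : Set I)).map
          fun p => (p.1.length - (clip a b p.1).length) • g p.2).sum := by
    have e := hL.sum_increment zero_le_one (F ∘ κ)
    have h0 : κ 0 = a := by
      show max a (min 0 b) = a
      exact max_eq_left ((min_le_left _ _).trans unitInterval.nonneg')
    have h1 : κ 1 = b := by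
      show max a (min 1 b) = b
      rw [min_eq_right unitInterval.le_one', max_eq_right hab]
    rw [Function.comp_apply, Function.comp_apply, h0, h1] at e
    rw [← e, riemannSum, ← sum_map_sub, List.map_congr_left hpt, sum_map_sub, List.map_map,
      sum_map_filter, sum_map_filter]
    rfl
  rw [norm_sub_rev, hsum]
  refine (norm_sub_le _ _).trans ?_
  have hA : ‖(((L.filter s).map c).map (defect F g)).sum‖ ≤ ε / 2 := by
    refine h1 _ ?_ ?_
    · refine List.Pairwise.map c (R := fun p q : ClosedSubinterval × I => p.1.NonOverlapping q.1)
        (fun p q hpq => ?_) (hL.nonOverlapping.filter _)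
      exact hpq.mono (Ioo_clip_subset _) (Ioo_clip_subset _)
    · intro q hq
      obtain ⟨p, hp, rfl⟩ := List.mem_map.1 hq
      have hp' := List.mem_filter.1 hp
      have hsp : s p := by simpa using hp'.2
      have hsub := clip_subset hsp.2.1 hsp.2.2
      exact (Icc_subset_Icc hsub.1 hsub.2).trans (hf1 p hp'.1)
  have hB : ‖((L.filter fun p => p.2 ∈ ({a, b} : Set I)).map
      fun p => (p.1.length - (clip a b p.1).length) • g p.2).sum‖ ≤ ε / 2 := by
    refine le_trans ?_ (h2 (L.filter fun p => p.2 ∈ ({a, b} : Set I)) (hL.nonOverlapping.filter _)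
      (hf2.filter _) fun p hp => by simpa using (List.mem_filter.1 hp).2)
    refine (norm_sum_map_le _ _).trans (List.sum_le_sum fun p _ => ?_)
    rw [norm_smul, Real.norm_eq_abs,
      abs_of_nonneg (sub_nonneg.2 (length_clip_le _))]
    refine mul_le_mul_of_nonneg_right ?_ (norm_nonneg _)
    linarith [(clip a b p.1).length_nonneg]
  linarith

end McShane

end TaggedList

/-! ### Vitali coverings by one-sided intervals -/

theorem dist_le_of_mem_uIcc {x s t : I} (hx : x ∈ uIcc s t) : dist x s ≤ dist t s := by
  rw [Subtype.dist_eq, Subtype.dist_eq, Real.dist_eq, Real.dist_eq]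
  refine abs_sub_left_of_mem_uIcc ?_
  rw [mem_uIcc] at hx ⊢
  exact hx

theorem dist_le_of_mem_uIcc_of_mem_uIcc {x y s t : I} (hx : x ∈ uIcc s t) (hy : y ∈ uIcc s t) :
    dist x y ≤ dist t s := by
  rw [Subtype.dist_eq, Subtype.dist_eq, Real.dist_eq, Real.dist_eq]
  refine abs_sub_le_of_uIcc_subset_uIcc ?_
  rw [uIcc_subset_uIcc_iff_mem, mem_uIcc, mem_uIcc]
  rw [mem_uIcc] at hx hy
  exact ⟨hy, hx⟩

theorem unitInterval.volume_closedBall_le (t : I) (r : ℝ) :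
    volume (Metric.closedBall t r) ≤ ENNReal.ofReal (2 * r) := by
  rw [unitInterval.volume_apply, ← Real.volume_closedBall (t : ℝ) r]
  refine measure_mono ?_
  rintro _ ⟨x, hx, rfl⟩
  exact hx

/-- **Vitali covering**: if arbitrarily short one-sided intervals at every point of `A` satisfy
`R`, then finitely many disjoint ones among them have total length larger than any given number
below the outer measure of `A`. -/
theorem exists_finset_pairwiseDisjoint_uIcc {A : Set I} {R : I → I → Prop}
    (hR : ∀ t ∈ A, ∀ r > 0, ∃ t', t' ≠ t ∧ dist t' t ≤ r ∧ R t t') {c : ℝ≥0∞}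
    (hc : c < volume A) : ∃ s : Finset (I × I),
      (∀ q ∈ s, q.1 ∈ A ∧ q.2 ≠ q.1 ∧ R q.1 q.2 ∧ 0 < volume (A ∩ uIcc q.1 q.2)) ∧
      (s : Set (I × I)).PairwiseDisjoint (fun q => uIcc q.1 q.2) ∧
      c < ∑ q ∈ s, edist q.2 q.1 := by
  obtain ⟨u, hut, huc, hud, hu⟩ := Vitali.exists_disjoint_covering_ae (volume : Measure I) A
    {q : I × I | q.1 ∈ A ∧ q.2 ≠ q.1 ∧ R q.1 q.2} 6 (fun q => dist q.2 q.1) (fun q => q.1)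
    (fun q => uIcc q.1 q.2) (fun q _ x hx => dist_le_of_mem_uIcc hx)
    (fun q _ => by
      refine (unitInterval.volume_closedBall_le _ _).trans ?_
      rw [unitInterval.volume_uIcc, edist_dist, ← mul_assoc, ENNReal.ofReal_mul (by norm_num)]
      gcongr
      norm_num)
    (fun q hq => by
      have h : q.1 ⊓ q.2 < q.1 ⊔ q.2 := inf_lt_sup.2 hq.2.1.symm
      obtain ⟨x, hx⟩ := exists_between h
      exact ⟨x, mem_interior.2 ⟨_, Ioo_subset_Icc_self, isOpen_Ioo, hx⟩⟩)
    (fun q _ => isClosed_Icc)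
    (fun t ht r hr => by
      obtain ⟨t', h1, h2, h3⟩ := hR t ht r hr
      exact ⟨(t, t'), ⟨ht, h1, h3⟩, h2, rfl⟩)
  set v : Set (I × I) := {q ∈ u | 0 < volume (A ∩ uIcc q.1 q.2)} with hv
  have hvc : v.Countable := huc.mono (sep_subset _ _)
  have hle : volume A ≤ ∑' q : v, edist q.1.2 q.1.1 := by
    have hsub : A ⊆ ((A \ ⋃ q ∈ u, uIcc q.1 q.2) ∪ ⋃ q ∈ u \ v, A ∩ uIcc q.1 q.2) ∪
        ⋃ q ∈ v, uIcc q.1 q.2 := by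
      intro x hx
      by_cases h : x ∈ ⋃ q ∈ u, uIcc q.1 q.2
      · obtain ⟨q, hq, hxq⟩ := mem_iUnion₂.1 h
        by_cases hqv : q ∈ v
        · exact Or.inr (mem_iUnion₂.2 ⟨q, hqv, hxq⟩)
        · exact Or.inl (Or.inr (mem_iUnion₂.2 ⟨q, ⟨hq, hqv⟩, hx, hxq⟩))
      · exact Or.inl (Or.inl ⟨hx, h⟩)
    have hnull : volume (⋃ q ∈ u \ v, A ∩ uIcc q.1 q.2) = 0 := by
      refine (measure_biUnion_null_iff (huc.mono sdiff_subset)).2 fun q hq => ?_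
      by_contra h
      exact hq.2 ⟨hq.1, pos_iff_ne_zero.2 h⟩
    calc volume A ≤ volume ((A \ ⋃ q ∈ u, uIcc q.1 q.2) ∪ ⋃ q ∈ u \ v, A ∩ uIcc q.1 q.2) +
          volume (⋃ q ∈ v, uIcc q.1 q.2) := (measure_mono hsub).trans (measure_union_le _ _)
      _ = volume (⋃ q ∈ v, uIcc q.1 q.2) := by
          rw [measure_union_null hu hnull, zero_add]
      _ ≤ ∑' q : v, volume (uIcc q.1.1 q.1.2) := measure_biUnion_le _ hvc _
      _ = _ := by simp
  rw [ENNReal.tsum_eq_iSup_sum] at hle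
  obtain ⟨s, hs⟩ := lt_iSup_iff.1 (hc.trans_le hle)
  refine ⟨s.map (Function.Embedding.subtype _), fun q hq => ?_, ?_, by simpa using hs⟩
  · obtain ⟨q, _, rfl⟩ := Finset.mem_map.1 hq
    have := hut q.2.1
    exact ⟨this.1, this.2.1, this.2.2, q.2.2⟩
  · refine hud.subset fun q hq => ?_
    obtain ⟨q, _, rfl⟩ := Finset.mem_map.1 hq
    exact q.2.1

namespace TaggedList

/-- The closed interval with end points `q.1` and `q.2`, in either order. -/
def spanned (q : I × I) : ClosedSubinterval := ⟨(q.1 ⊓ q.2, q.1 ⊔ q.2), inf_le_sup⟩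

/-- The list of the intervals spanned by the pairs in `s`, tagged by `τ`. -/
noncomputable def spannedList (s : Finset (I × I)) (τ : I × I → I) :
    List (ClosedSubinterval × I) :=
  s.toList.map fun q => (spanned q, τ q)

theorem nonOverlapping_spannedList {s : Finset (I × I)} (τ : I × I → I)
    (hs : (s : Set (I × I)).PairwiseDisjoint fun q => uIcc q.1 q.2) :
    NonOverlapping (spannedList s τ) := by
  refine List.pairwise_map.2 (List.Nodup.pairwise_of_forall_ne s.nodup_toList
    fun q hq q' hq' hne => ?_)
  exact (hs (Finset.mem_coe.2 (Finset.mem_toList.1 hq)) (Finset.mem_coe.2 (Finset.mem_toList.1 hq'))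
    hne).mono Ioo_subset_Icc_self Ioo_subset_Icc_self

theorem mem_spannedList {s : Finset (I × I)} {τ : I × I → I} {p : ClosedSubinterval × I}
    (hp : p ∈ spannedList s τ) : ∃ q ∈ s, p = (spanned q, τ q) := by
  obtain ⟨q, hq, rfl⟩ := List.mem_map.1 hp
  exact ⟨q, Finset.mem_toList.1 hq, rfl⟩

theorem sum_spannedList {M : Type*} [AddCommMonoid M] (s : Finset (I × I)) (τ : I × I → I)
    (φ : ClosedSubinterval × I → M) :
    ((spannedList s τ).map φ).sum = ∑ q ∈ s, φ (spanned q, τ q) := by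
  rw [spannedList, List.map_map, ← Finset.sum_map_toList]
  rfl

section Deriv

variable {Y : Type*} [NormedAddCommGroup Y]

theorem norm_increment_spanned (F : I → Y) (q : I × I) :
    ‖(spanned q).increment F‖ = ‖F q.2 - F q.1‖ := by
  rcases le_total q.1 q.2 with h | h
  · simp [spanned, ClosedSubinterval.increment, h]
  · simp [spanned, ClosedSubinterval.increment, h, norm_sub_rev]

variable [NormedSpace ℝ Y]

theorem norm_defect_spanned (F g : I → Y) (q : I × I) :
    ‖defect F g (spanned q, q.1)‖ = ‖F q.2 - F q.1 - ((q.2 : ℝ) - q.1) • g q.1‖ := by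
  rcases le_total q.1 q.2 with h | h
  · simp [spanned, defect, ClosedSubinterval.increment, ClosedSubinterval.length, h]
  · simp only [spanned, defect, ClosedSubinterval.increment, ClosedSubinterval.length, h,
      inf_of_le_right, sup_of_le_left]
    rw [← norm_neg]
    congr 1
    module

/-- `F` has derivative `y` at the point `t` of `[0,1]`. -/
def HasIntervalDeriv (F : I → Y) (y : Y) (t : I) : Prop :=
  ∀ ε > 0, ∃ η > 0, ∀ t' : I, dist t' t < η → ‖F t' - F t - ((t' : ℝ) - t) • y‖ ≤ ε * dist t' t

/-- The conclusion of the Saks–Henstock lemma in its variational form. -/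
def VariationalHenstock (F g : I → Y) : Prop :=
  ∀ ε > 0, ∃ δ : I → ℝ, IsGauge δ ∧ ∀ L, NonOverlapping L → IsPerron L → IsFine δ L →
    (L.map fun p => ‖defect F g p‖).sum ≤ ε

/-- The variational measure of `F` vanishes on null sets. -/
def NullVariation (F : I → Y) : Prop :=
  ∀ N : Set I, volume N = 0 → ∀ ε > 0, ∃ δ : I → ℝ, IsGauge δ ∧ ∀ L, NonOverlapping L →
    IsPerron L → IsFine δ L → (∀ p ∈ L, p.2 ∈ N) → (L.map fun p => ‖p.1.increment F‖).sum ≤ ε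

/-- A variational Henstock primitive is differentiable almost everywhere. -/
theorem VariationalHenstock.ae_hasIntervalDeriv {F g : I → Y} (h : VariationalHenstock F g) :
    ∀ᵐ t : I, HasIntervalDeriv F (g t) t := by
  set bad : ℕ → Set I := fun j => {t | ∀ η > 0, ∃ t' : I, dist t' t < η ∧
    1 / ((j : ℝ) + 1) * dist t' t < ‖F t' - F t - ((t' : ℝ) - t) • g t‖} with hbad
  have hnull : ∀ j, volume (bad j) = 0 := by
    intro j
    by_contra hpos
    obtain ⟨c, hc0, hc⟩ := exists_between (pos_iff_ne_zero.2 hpos)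
    have hctop : c ≠ ⊤ := (hc.trans_le le_top).ne
    have hj : 0 < 1 / ((j : ℝ) + 1) := by positivity
    have hε : 0 < 1 / ((j : ℝ) + 1) * c.toReal :=
      mul_pos hj (ENNReal.toReal_pos hc0.ne' hctop)
    obtain ⟨δ, hδ, hL⟩ := h _ hε
    obtain ⟨s, hs, hsd, hsc⟩ := exists_finset_pairwiseDisjoint_uIcc (A := bad j)
      (R := fun t t' => dist t' t < δ t ∧
        1 / ((j : ℝ) + 1) * dist t' t ≤ ‖F t' - F t - ((t' : ℝ) - t) • g t‖)
      (fun t ht r hr => by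
        obtain ⟨t', h1, h2⟩ := ht (min r (δ t)) (lt_min hr (hδ t))
        refine ⟨t', ?_, (h1.trans_le (min_le_left _ _)).le, h1.trans_le (min_le_right _ _), h2.le⟩
        rintro rfl
        simp at h2) hc
    have hle := hL (spannedList s Prod.fst) (nonOverlapping_spannedList _ hsd)
      (fun p hp => by
        obtain ⟨q, hq, rfl⟩ := mem_spannedList hp
        exact left_mem_uIcc)
      (fun p hp => by
        obtain ⟨q, hq, rfl⟩ := mem_spannedList hp
        exact fun x hx => (dist_le_of_mem_uIcc hx).trans_lt (hs q hq).2.2.1.1)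
    rw [sum_spannedList] at hle
    have h1 : 1 / ((j : ℝ) + 1) * ∑ q ∈ s, dist q.2 q.1 ≤ 1 / ((j : ℝ) + 1) * c.toReal := by
      refine le_trans ?_ hle
      rw [Finset.mul_sum]
      refine Finset.sum_le_sum fun q hq => ?_
      rw [norm_defect_spanned]
      exact (hs q hq).2.2.1.2
    have h2 := le_of_mul_le_mul_left h1 hj
    have h3 : ∑ q ∈ s, edist q.2 q.1 = ENNReal.ofReal (∑ q ∈ s, dist q.2 q.1) := by
      rw [ENNReal.ofReal_sum_of_nonneg fun _ _ => dist_nonneg]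
      simp only [edist_dist]
    rw [h3] at hsc
    exact absurd (ENNReal.ofReal_le_of_le_toReal h2) (not_le.2 hsc)
  have hae : ∀ᵐ t : I, ∀ j, t ∉ bad j :=
    ae_all_iff.2 fun j => measure_eq_zero_iff_ae_notMem.1 (hnull j)
  filter_upwards [hae] with t ht ε hε
  obtain ⟨j, hj⟩ := exists_nat_one_div_lt hε
  have := ht j
  simp only [hbad, mem_ofPred_eq, not_forall, not_exists, not_and, not_lt] at this
  obtain ⟨η, hη, hh⟩ := this
  exact ⟨η, hη, fun t' ht' => (hh t' ht').trans (mul_le_mul_of_nonneg_right hj.le dist_nonneg)⟩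

/-- The variational measure of a variational Henstock primitive vanishes on null sets. -/
theorem VariationalHenstock.nullVariation {F g : I → Y} (h : VariationalHenstock F g) :
    NullVariation F := by
  intro N hN ε hε
  obtain ⟨δ1, hδ1, h1⟩ := h _ (half_pos hε)
  obtain ⟨δ2, hδ2, h2⟩ := exists_gauge_sum_le_of_null hN (fun t => ‖g t‖) (half_pos hε)
  refine ⟨_, isGauge_min hδ1 hδ2, fun L hL hLp hLf hLN => ?_⟩
  have e1 := h1 L hL hLp (hLf.mono fun t => min_le_left _ _)
  have e2 := h2 L hL (hLf.mono fun t => min_le_right _ _) hLN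
  have e3 : (L.map fun p => ‖p.1.increment F‖).sum ≤
      (L.map fun p => ‖defect F g p‖ + p.1.length * ‖g p.2‖).sum := by
    refine List.sum_le_sum fun p _ => ?_
    have : p.1.increment F = defect F g p + p.1.length • g p.2 := by simp [defect]
    rw [this]
    refine (norm_add_le _ _).trans_eq ?_
    rw [norm_smul, Real.norm_eq_abs, abs_of_nonneg p.1.length_nonneg]
  rw [List.sum_map_add] at e3
  linarith

end Deriv

end TaggedList

/-! ### Null variation implies bounded difference quotients almost everywhere -/

/-- A finite sum of small nonnegative terms that exceeds `θ` has a partial sum which exceeds `θ`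
only slightly. -/
theorem exists_subset_sum_between {α : Type*} (s : Finset α) (f : α → ℝ) {θ η : ℝ}
    (hη : 0 ≤ η) (hf : ∀ q ∈ s, f q ≤ η / 2) (hθ : θ ≤ η / 2) (hs : θ ≤ ∑ q ∈ s, f q) :
    ∃ t ⊆ s, θ ≤ ∑ q ∈ t, f q ∧ ∑ q ∈ t, f q ≤ η := by
  classical
  induction s using Finset.induction_on with
  | empty => exact ⟨∅, le_rfl, hs, by simpa using hη⟩
  | insert a s ha ih =>
    by_cases h : θ ≤ ∑ q ∈ s, f q
    · obtain ⟨t, ht, h'⟩ := ih (fun q hq => hf q (Finset.mem_insert_of_mem hq)) h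
      exact ⟨t, ht.trans (Finset.subset_insert _ _), h'⟩
    · refine ⟨insert a s, le_rfl, hs, ?_⟩
      rw [Finset.sum_insert ha]
      linarith [hf a (Finset.mem_insert_self _ _), not_le.1 h]

namespace TaggedList

section Lipschitz

variable {Y : Type*} [NormedAddCommGroup Y]

/-- The points at which `F` satisfies a one-point Lipschitz condition with constant `k + 1` in the
neighbourhood of radius `1 / (k + 1)`. -/
def lipschitzPoints (F : I → Y) (k : ℕ) : Set I :=
  {t | ∀ t' : I, dist t' t < 1 / ((k : ℝ) + 1) → ‖F t' - F t‖ ≤ (k + 1) * dist t' t}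

theorem isClosed_lipschitzPoints {F : I → Y} (hF : Continuous F) (k : ℕ) :
    IsClosed (lipschitzPoints F k) := by
  have : lipschitzPoints F k = ⋂ t' : I, {t : I | 1 / ((k : ℝ) + 1) ≤ dist t' t} ∪
      {t : I | ‖F t' - F t‖ ≤ (k + 1) * dist t' t} := by
    ext t
    simp only [lipschitzPoints, mem_ofPred_eq, mem_iInter, mem_union, or_iff_not_imp_left, not_le]
  rw [this]
  refine isClosed_iInter fun t' => IsClosed.union ?_ ?_
  · exact isClosed_le continuous_const (by fun_prop)
  · exact isClosed_le (by fun_prop) (by fun_prop)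

/-- If the difference quotients of `F` are unbounded at every point of `Z`, then any open set that
meets the support of `λ|_Z` contains short disjoint intervals over which `F` has large variation. -/
theorem exists_short_intervals_of_unbounded {F : I → Y} {Z : Set I}
    (hZ : ∀ t ∈ Z, ∀ k, t ∉ lipschitzPoints F k) {B : Set I} (hB : IsOpen B)
    (hBK : (B ∩ ((volume : Measure I).restrict Z).support).Nonempty) {η : ℝ} (hη : 0 < η) :
    ∃ s : Finset (I × I), (∀ q ∈ s, uIcc q.1 q.2 ⊆ B ∧ dist q.2 q.1 ≤ η ∧
        (uIoo q.1 q.2 ∩ ((volume : Measure I).restrict Z).support).Nonempty) ∧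
      (s : Set (I × I)).PairwiseDisjoint (fun q => uIcc q.1 q.2) ∧
      ∑ q ∈ s, dist q.2 q.1 ≤ η ∧ 1 ≤ ∑ q ∈ s, ‖F q.2 - F q.1‖ := by
  set K := ((volume : Measure I).restrict Z).support with hK
  have hpos : 0 < volume (B ∩ K ∩ Z) := by
    obtain ⟨x, hxB, hxK⟩ := hBK
    have hmeas : MeasurableSet (B ∩ K) :=
      hB.measurableSet.inter Measure.isClosed_support.measurableSet
    rw [← Measure.restrict_apply hmeas]
    have h1 := (Measure.mem_support_iff_forall x).1 hxK B (hB.mem_nhds hxB)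
    rwa [measure_inter_conull]
    exact Measure.measure_compl_support
  obtain ⟨c, hc0, hc⟩ := exists_between hpos
  have hctop : c ≠ ⊤ := (hc.trans_le le_top).ne
  have hcpos := ENNReal.toReal_pos hc0.ne' hctop
  set θ := min (η / 2) c.toReal with hθ
  have hθ0 : 0 < θ := lt_min (half_pos hη) hcpos
  obtain ⟨s, hs, hsd, hsc⟩ := exists_finset_pairwiseDisjoint_uIcc (A := B ∩ K ∩ Z)
    (R := fun t t' => uIcc t t' ⊆ B ∧ dist t' t ≤ η / 2 ∧ 1 / θ * dist t' t ≤ ‖F t' - F t‖)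
    (fun t ht r hr => by
      obtain ⟨ρ, hρ, hρB⟩ := Metric.isOpen_iff.1 hB t ht.1.1
      obtain ⟨k, hk⟩ := exists_nat_one_div_lt (lt_min hr (lt_min hρ (lt_min (half_pos hη) hθ0)))
      have hk' := hZ t ht.2 k
      simp only [lipschitzPoints, mem_ofPred_eq, not_forall, not_le] at hk'
      obtain ⟨t', h1, h2⟩ := hk'
      have h3 := h1.trans hk
      simp only [lt_min_iff] at h3 hk
      refine ⟨t', ?_, h3.1.le, fun x hx => hρB ((dist_le_of_mem_uIcc hx).trans_lt h3.2.1),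
        h3.2.2.1.le, le_trans (mul_le_mul_of_nonneg_right ?_ dist_nonneg) h2.le⟩
      · rintro rfl
        simp at h2
      · exact (one_div_le (by positivity) hθ0).1 hk.2.2.2.le) hc
  have hsum : ∑ q ∈ s, edist q.2 q.1 = ENNReal.ofReal (∑ q ∈ s, dist q.2 q.1) := by
    rw [ENNReal.ofReal_sum_of_nonneg fun _ _ => dist_nonneg]
    simp only [edist_dist]
  rw [hsum] at hsc
  have hle : θ ≤ ∑ q ∈ s, dist q.2 q.1 :=
    (min_le_right _ _).trans ((ENNReal.lt_ofReal_iff_toReal_lt hctop).1 hsc).le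
  obtain ⟨s', hs', h1, h2⟩ := exists_subset_sum_between s (fun q => dist q.2 q.1) hη.le
    (fun q hq => (hs q hq).2.2.1.2.1) (min_le_left _ _) hle
  refine ⟨s', fun q hq => ?_, hsd.subset (Finset.coe_subset.2 hs'), h2, ?_⟩
  · have hq := hs q (hs' hq)
    refine ⟨hq.2.2.1.1, hq.2.2.1.2.1.trans (half_le_self hη.le), ?_⟩
    by_contra hempty
    -- Otherwise only the end points of the interval could belong to `B ∩ K ∩ Z`.
    have hsub : B ∩ K ∩ Z ∩ uIcc q.1 q.2 ⊆ {q.1 ⊓ q.2, q.1 ⊔ q.2} := by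
      rintro x ⟨⟨⟨_, hxK⟩, _⟩, hx1, hx2⟩
      rcases hx1.eq_or_lt with h | h
      · exact Or.inl h.symm
      rcases hx2.eq_or_lt with h' | h'
      · exact Or.inr h'
      exact absurd ⟨x, ⟨h, h'⟩, hxK⟩ hempty
    exact hq.2.2.2.ne' (measure_mono_null hsub ((Set.toFinite _).measure_zero _))
  · have h3 : 1 / θ * ∑ q ∈ s', dist q.2 q.1 ≤ ∑ q ∈ s', ‖F q.2 - F q.1‖ := by
      rw [Finset.mul_sum]
      exact Finset.sum_le_sum fun q hq => (hs q (hs' hq)).2.2.1.2.2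
    refine le_trans ?_ h3
    rw [one_div, ← div_eq_inv_mul, one_le_div hθ0]
    exact h1

/-- If the variational measure of `F` vanishes on null sets, then the difference quotients of `F`
are bounded at almost every point. Otherwise let `K` be the support of Lebesgue measure on the set
of the other points. There is a null dense `G_δ` subset `N` of `K` made of points lying in
infinitely many of the intervals given by `exists_short_intervals_of_unbounded`. By Baire's theorem, every
gauge on `N` is bounded below on a set which is dense in some portion of `K`, and the short
intervals in this portion show that the variational measure of `N` is at least `1`. -/
theorem NullVariation.ae_exists_mem_lipschitzPoints {F : I → Y} (hV : NullVariation F) :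
    ∀ᵐ t : I, ∃ k, t ∈ lipschitzPoints F k := by
  set Z : Set I := {t | ¬ ∃ k, t ∈ lipschitzPoints F k} with hZdef
  have hZ : ∀ t ∈ Z, ∀ k, t ∉ lipschitzPoints F k := fun t ht k hk => ht ⟨k, hk⟩
  by_contra hae
  have hZpos : volume Z ≠ 0 := hae
  set K := ((volume : Measure I).restrict Z).support with hK
  have hKne : K.Nonempty := Measure.nonempty_support (by
    rwa [Ne, Measure.restrict_eq_zero])
  have hKcl : IsClosed K := Measure.isClosed_support
  obtain ⟨b, hbc, -, hb⟩ := TopologicalSpace.exists_countable_basis I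
  have : Countable b := hbc.to_subtype
  obtain ⟨ε', hε', hsum⟩ := ENNReal.exists_pos_sum_of_countable (ε := 1) one_ne_zero (ℕ × b)
  have hfam : ∀ (n : ℕ) (B : b), ∃ s : Finset (I × I), (∀ q ∈ s, uIcc q.1 q.2 ⊆ B.1 ∧
      dist q.2 q.1 ≤ 1 / ((n : ℝ) + 1) ∧ (uIoo q.1 q.2 ∩ K).Nonempty) ∧
      (s : Set (I × I)).PairwiseDisjoint (fun q => uIcc q.1 q.2) ∧
      ∑ q ∈ s, dist q.2 q.1 ≤ ε' (n, B) ∧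
      ((B.1 ∩ K).Nonempty → 1 ≤ ∑ q ∈ s, ‖F q.2 - F q.1‖) := by
    intro n B
    by_cases hBK : (B.1 ∩ K).Nonempty
    · obtain ⟨s, h1, h2, h3, h4⟩ := exists_short_intervals_of_unbounded hZ
        (hb.isOpen B.2) hBK (η := min (1 / ((n : ℝ) + 1)) (ε' (n, B)))
        (lt_min (by positivity) (by exact_mod_cast hε' (n, B)))
      exact ⟨s, fun q hq => ⟨(h1 q hq).1, (h1 q hq).2.1.trans (min_le_left _ _), (h1 q hq).2.2⟩,
        h2, h3.trans (min_le_right _ _), fun _ => h4⟩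
    · exact ⟨∅, by simp, by simp, by simp, fun h => absurd h hBK⟩
  choose s hs hsd hsl hsF using hfam
  set W : ℕ → Set I := fun n => ⋃ B : b, ⋃ q ∈ s n B, uIoo q.1 q.2 with hW
  have hWo : ∀ n, IsOpen (W n) := fun n =>
    isOpen_iUnion fun B => isOpen_biUnion fun q _ => isOpen_Ioo
  have hWsum : ∑' n, volume (W n) ≠ ⊤ := by
    have hle : ∀ n, volume (W n) ≤ ∑' B : b, (ε' (n, B) : ℝ≥0∞) := by
      intro n
      refine (measure_iUnion_le _).trans (ENNReal.tsum_le_tsum fun B => ?_)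
      refine (measure_biUnion_finset_le _ _).trans ?_
      have h1 : ∑ q ∈ s n B, volume (uIoo q.1 q.2) =
          ENNReal.ofReal (∑ q ∈ s n B, dist q.2 q.1) := by
        rw [ENNReal.ofReal_sum_of_nonneg fun _ _ => dist_nonneg]
        simp only [unitInterval.volume_uIoo, edist_dist]
      rw [h1]
      exact (ENNReal.ofReal_le_ofReal (hsl n B)).trans_eq (ENNReal.ofReal_coe_nnreal)
    have h2 : ∑' n, ∑' B : b, (ε' (n, B) : ℝ≥0∞) < 1 := by
      rwa [← ENNReal.tsum_prod (f := fun n B => (ε' (n, B) : ℝ≥0∞))]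
    exact ((ENNReal.tsum_le_tsum hle).trans_lt (h2.trans ENNReal.one_lt_top)).ne
  set N : Set I := K ∩ limsup W atTop with hN
  have hNnull : volume N = 0 :=
    measure_mono_null inter_subset_right (measure_limsup_atTop_eq_zero hWsum)
  have hmemN : ∀ t, t ∈ K → (∀ j : ℕ, ∃ n ≥ j, t ∈ W n) → t ∈ N := by
    intro t ht h
    refine ⟨ht, ?_⟩
    rw [mem_limsup_iff_frequently_mem, frequently_atTop]
    exact h
  obtain ⟨δ, hδ, hL⟩ := hV N hNnull (1 / 2) (by norm_num)
  have hmeet : ∀ (n : ℕ) (B : b), (B.1 ∩ K).Nonempty → (B.1 ∩ K ∩ W n).Nonempty := by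
    intro n B hBK
    have h1 := hsF n B hBK
    have hne : (s n B).Nonempty := by
      by_contra h
      rw [Finset.not_nonempty_iff_eq_empty.1 h, Finset.sum_empty] at h1
      norm_num at h1
    obtain ⟨q, hq⟩ := hne
    obtain ⟨y, hy, hyK⟩ := (hs n B q hq).2.2
    exact ⟨y, ⟨(hs n B q hq).1 (Ioo_subset_Icc_self hy), hyK⟩,
      mem_iUnion.2 ⟨B, mem_iUnion₂.2 ⟨q, hq, hy⟩⟩⟩
  set O : ℕ → Set K := fun j => Subtype.val ⁻¹' ⋃ n ≥ j, W n with hO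
  have hOo : ∀ j, IsOpen (O j) := fun j =>
    (isOpen_biUnion fun n _ => hWo n).preimage continuous_subtype_val
  have hOd : ∀ j, Dense (O j) := by
    intro j
    rw [dense_iff_inter_open]
    rintro _ ⟨V, hV, rfl⟩ ⟨x, hx⟩
    obtain ⟨B, hBb, hxB, hBV⟩ := hb.exists_subset_of_mem_open hx hV
    obtain ⟨y, ⟨hyB, hyK⟩, hyW⟩ := hmeet j ⟨B, hBb⟩ ⟨x, hxB, x.2⟩
    exact ⟨⟨y, hyK⟩, hBV hyB, mem_iUnion₂.2 ⟨j, le_rfl, hyW⟩⟩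
  set D : ℕ → Set I := fun m => {t ∈ N | 1 / ((m : ℝ) + 1) < δ t} with hD
  set C : ℕ → Set K := fun m => closure (Subtype.val ⁻¹' D m) with hC
  obtain ⟨m, hm⟩ : ∃ m, (interior (C m)).Nonempty := by
    by_contra! hempty
    have : CompactSpace K := isCompact_iff_compactSpace.1 hKcl.isCompact
    have : Nonempty K := hKne.to_subtype
    have hdense : Dense (⋂ j, O j ∩ (C j)ᶜ) := by
      refine dense_iInter_of_isOpen (fun j => (hOo j).inter isClosed_closure.isOpen_compl)
        fun j => (hOd j).inter_of_isOpen_left ?_ (hOo j)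
      exact interior_eq_empty_iff_dense_compl.1 (hempty j)
    obtain ⟨t, ht⟩ := hdense.nonempty
    rw [mem_iInter] at ht
    have htN : t.1 ∈ N := by
      refine hmemN t t.2 fun j => ?_
      obtain ⟨n, hn, h⟩ := mem_iUnion₂.1 (ht j).1
      exact ⟨n, hn, h⟩
    obtain ⟨m, hm⟩ := exists_nat_one_div_lt (hδ t)
    exact (ht m).2 (subset_closure ⟨htN, hm⟩)
  obtain ⟨V, hVo, hVeq⟩ := isOpen_interior (s := C m)
  obtain ⟨x, hx⟩ := hm
  have hxV : x.1 ∈ V := by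
    have : x ∈ Subtype.val ⁻¹' V := hVeq ▸ hx
    exact this
  obtain ⟨B, hBb, hxB, hBV⟩ := hb.exists_subset_of_mem_open hxV hVo
  have htag : ∀ q, ∃ t, q ∈ s m ⟨B, hBb⟩ → t ∈ uIoo q.1 q.2 ∧ t ∈ D m := by
    intro q
    by_cases hq : q ∈ s m ⟨B, hBb⟩
    · obtain ⟨hqB, -, y, hy, hyK⟩ := hs m ⟨B, hBb⟩ q hq
      have hyC : (⟨y, hyK⟩ : K) ∈ C m := by
        refine interior_subset ?_
        rw [← hVeq]
        exact hBV (hqB (Ioo_subset_Icc_self hy))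
      obtain ⟨t, ht1, ht2⟩ := mem_closure_iff.1 hyC (Subtype.val ⁻¹' uIoo q.1 q.2)
        (isOpen_Ioo.preimage continuous_subtype_val) hy
      exact ⟨t, fun _ => ⟨ht1, ht2⟩⟩
    · exact ⟨0, fun h => absurd h hq⟩
  choose τ hτ using htag
  have hle := hL (spannedList (s m ⟨B, hBb⟩) τ) (nonOverlapping_spannedList _ (hsd _ _))
    (fun p hp => by
      obtain ⟨q, hq, rfl⟩ := mem_spannedList hp
      exact Ioo_subset_Icc_self (hτ q hq).1)
    (fun p hp => by
      obtain ⟨q, hq, rfl⟩ := mem_spannedList hp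
      intro x hx
      refine (dist_le_of_mem_uIcc_of_mem_uIcc hx (Ioo_subset_Icc_self (hτ q hq).1)).trans_lt ?_
      exact (hs m ⟨B, hBb⟩ q hq).2.1.trans_lt (hτ q hq).2.2)
    (fun p hp => by
      obtain ⟨q, hq, rfl⟩ := mem_spannedList hp
      exact (hτ q hq).2.1)
  rw [sum_spannedList] at hle
  have h1 := hsF m ⟨B, hBb⟩ ⟨x, hxB, x.2⟩
  simp only [norm_increment_spanned] at hle
  linarith

end Lipschitz

end TaggedList

/-! ### Differentiability of a McShane primitive with null variation -/

namespace TaggedList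

/-- Almost every point of a closed set is a density point of it. -/
theorem ae_density {E : Set I} (hE : IsClosed E) : ∀ᵐ t : I, t ∈ E → ∀ θ > 0, ∃ η > 0,
    ∀ t' : I, dist t' t < η → volume.real (uIoc t t' \ E) ≤ θ * dist t' t := by
  set S : Set ℝ := (Subtype.val '' E)ᶜ with hS
  have hSm : MeasurableSet S :=
    ((hE.isCompact.image continuous_subtype_val).isClosed.measurableSet).compl
  have h1 := unitInterval.measurePreserving_coe.quasiMeasurePreserving.ae
    (ae_restrict_of_ae (s := unitInterval)
      (Besicovitch.ae_tendsto_measure_inter_div_of_measurableSet (volume : Measure ℝ) hSm))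
  filter_upwards [h1] with t ht htE θ hθ
  have htS : (t : ℝ) ∉ S := fun h => h ⟨t, htE, rfl⟩
  rw [indicator_of_notMem htS] at ht
  have hθ' : 0 < ENNReal.ofReal (θ / 2) := ENNReal.ofReal_pos.2 (half_pos hθ)
  obtain ⟨η, hη, h⟩ := mem_nhdsGT_iff_exists_Ioo_subset.1 (ht.eventually (gt_mem_nhds hθ'))
  refine ⟨η, hη, fun t' ht' => ?_⟩
  rcases eq_or_ne t' t with rfl | hne
  · simp
  have hr : 0 < dist t' t := dist_pos.2 hne
  have h2 : volume (S ∩ Metric.closedBall (t : ℝ) (dist t' t)) /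
      volume (Metric.closedBall (t : ℝ) (dist t' t)) < ENNReal.ofReal (θ / 2) := h ⟨hr, ht'⟩
  rw [Real.volume_closedBall] at h2
  have h3 : volume (uIoc t t' \ E) ≤ volume (S ∩ Metric.closedBall (t : ℝ) (dist t' t)) := by
    rw [unitInterval.volume_apply]
    refine measure_mono ?_
    rintro _ ⟨x, ⟨hx, hxE⟩, rfl⟩
    refine ⟨?_, dist_le_of_mem_uIcc (Ioc_subset_Icc_self hx)⟩
    rintro ⟨y, hy, hyx⟩
    exact hxE (Subtype.ext hyx ▸ hy)
  have h4 : volume (uIoc t t' \ E) ≤ ENNReal.ofReal (θ * dist t' t) := by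
    refine h3.trans ?_
    have h5 := (ENNReal.div_lt_iff (Or.inl (by positivity)) (Or.inl ENNReal.ofReal_ne_top)).1 h2
    refine h5.le.trans_eq ?_
    rw [← ENNReal.ofReal_mul (by positivity)]
    congr 1
    ring
  exact ENNReal.toReal_le_of_le_ofReal (by positivity) h4

/-- A property which holds almost everywhere on each closed subset of a measurable set holds almost
everywhere on this set. -/
theorem ae_of_forall_closed_subset {M : Set I} (hM : NullMeasurableSet M) {Q : I → Prop}
    (h : ∀ E ⊆ M, IsClosed E → ∀ᵐ t : I, t ∈ E → Q t) : ∀ᵐ t : I, t ∈ M → Q t := by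
  obtain ⟨M', hM', hM'm, hae⟩ := hM.exists_measurable_subset_ae_eq
  have hε : ∀ n : ℕ, ((n : ℝ≥0∞) + 1)⁻¹ ≠ 0 := fun n => by simp
  choose E hEM hEc hE using fun n : ℕ =>
    hM'm.exists_isClosed_sdiff_lt (measure_ne_top volume M') (hε n)
  have hnull : volume (M' \ ⋃ n, E n) = 0 := by
    have hlim : Tendsto (fun n : ℕ => ((n : ℝ≥0∞) + 1)⁻¹) atTop (𝓝 0) := by
      have := (tendsto_add_atTop_iff_nat 1).2 ENNReal.tendsto_inv_nat_nhds_zero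
      simpa using this
    refine le_antisymm (ge_of_tendsto' hlim fun n => ?_) zero_le
    exact (measure_mono (sdiff_subset_sdiff_right (subset_iUnion E n))).trans (hE n).le
  have h1 : ∀ᵐ t : I, ∀ n, t ∈ E n → Q t :=
    ae_all_iff.2 fun n => h (E n) ((hEM n).trans hM') (hEc n)
  filter_upwards [h1, measure_eq_zero_iff_ae_notMem.1 hnull, hae.mem_iff] with t h1 h2 h3 ht
  by_contra hQ
  refine h2 ⟨h3.2 ht, fun h4 => ?_⟩
  obtain ⟨n, hn⟩ := mem_iUnion.1 h4
  exact hQ (h1 n hn)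

section

variable {Y : Type*} [NormedAddCommGroup Y] [NormedSpace ℝ Y]

theorem SaksHenstock.continuous {F g : I → Y} (h : SaksHenstock F g) : Continuous F := by
  refine Metric.continuous_iff.2 fun t ε hε => ?_
  obtain ⟨δ, hδ, hL⟩ := h (ε / 2) (half_pos hε)
  have hpos : 0 < ε / 2 / (‖g t‖ + 1) := by positivity
  refine ⟨min (δ t) (ε / 2 / (‖g t‖ + 1)), lt_min (hδ t) hpos, fun t' ht' => ?_⟩
  have h1 := hL [(spanned (t, t'), t)] (List.pairwise_singleton _ _) (fun p hp => by
    obtain rfl := List.mem_singleton.1 hp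
    exact fun x hx => (dist_le_of_mem_uIcc hx).trans_lt (ht'.trans_le (min_le_left _ _)))
  rw [List.map_singleton, List.sum_singleton, norm_defect_spanned F g (t, t')] at h1
  have h2 : ‖((t' : ℝ) - t) • g t‖ < ε / 2 := by
    rw [norm_smul, ← dist_eq_norm]
    have h3 : dist (t' : ℝ) t < ε / 2 / (‖g t‖ + 1) := ht'.trans_le (min_le_right _ _)
    rw [lt_div_iff₀ (by positivity)] at h3
    refine lt_of_le_of_lt ?_ h3
    gcongr
    linarith
  rw [dist_eq_norm]
  calc ‖F t' - F t‖ = ‖(F t' - F t - ((t' : ℝ) - t) • g t) + ((t' : ℝ) - t) • g t‖ := by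
        rw [sub_add_cancel]
    _ < ε := (norm_add_le _ _).trans_lt (by linarith)

theorem SaksHenstock.sub_const {F g : I → Y} (h : SaksHenstock F g) (y : Y) :
    SaksHenstock (fun t => F t - (t : ℝ) • y) (fun t => g t - y) := by
  have : defect (fun t => F t - (t : ℝ) • y) (fun t => g t - y) = defect F g := by
    funext p
    simp only [defect, ClosedSubinterval.increment, ClosedSubinterval.length]
    module
  unfold SaksHenstock
  rwa [this]

/-- If a McShane primitive `F` of `g` satisfies a one-point Lipschitz condition at the points of the
closed set `E`, and `‖g‖ ≤ ε` on `E`, then the variation of `F` over an interval is essentially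
controlled by the part of the interval outside of `E`. The proof compares `F` with the function
`x ↦ F (e x)`, where `e x` is the last point of `E` before `x`: it is constant on the intervals
that miss `E`, and its increments over the intervals that meet `E` are close to those of `F`. -/
theorem SaksHenstock.norm_sub_le_of_left_mem {F g : I → Y} (h : SaksHenstock F g) {E : Set I}
    (hE : IsClosed E) {r κ ε : ℝ} (hκ : 0 ≤ κ)
    (hLip : ∀ t ∈ E, ∀ t' : I, dist t' t < r → ‖F t' - F t‖ ≤ κ * dist t' t)
    (hg : ∀ t ∈ E, ‖g t‖ ≤ ε) {c d : I} (hc : c ∈ E) (hcd : c ≤ d) (hr : (d : ℝ) - c < r) :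
    ‖F d - F c‖ ≤ ε * ((d : ℝ) - c) + 2 * κ * volume.real (Ioc c d \ E) := by
  classical
  set e : I → I := fun x => sSup (E ∩ Iic x) with he
  have he_mem : ∀ x, c ≤ x → e x ∈ E ∩ Iic x := fun x hx =>
    (hE.inter isClosed_Iic).isCompact.sSup_mem ⟨c, hc, hx⟩
  have he_le : ∀ {x z : I}, z ∈ E → z ≤ x → z ≤ e x := fun hz hzx => le_sSup ⟨hz, hzx⟩
  set n : I → ℝ := fun x => (x : ℝ) - e x with hn
  set m : I → ℝ := fun x => volume.real (Iic x \ E) with hm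
  have hmeas : ∀ x z : I, MeasurableSet (Ioc x z \ E) := fun x z =>
    measurableSet_Ioc.diff hE.measurableSet
  have hm_sub : ∀ {x z : I}, x ≤ z → m z - m x = volume.real (Ioc x z \ E) := by
    intro x z hxz
    have hunion : Iic z \ E = (Iic x \ E) ∪ (Ioc x z \ E) := by
      rw [← union_sdiff_distrib, Iic_union_Ioc_eq_Iic hxz]
    have hdisj : Disjoint (Iic x \ E) (Ioc x z \ E) :=
      Disjoint.mono sdiff_subset sdiff_subset
        (Set.disjoint_left.2 fun w hw hw' => absurd hw'.1 (not_lt.2 hw))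
    show volume.real (Iic z \ E) - volume.real (Iic x \ E) = _
    rw [hunion, measureReal_union hdisj (hmeas x z)]
    ring
  have hlen : ∀ {x z : I}, x ≤ z → volume.real (Ioc x z) = (z : ℝ) - x := by
    intro x z hxz
    rw [measureReal_def, unitInterval.volume_Ioc, ENNReal.toReal_ofReal (sub_nonneg.2 hxz)]
  have hFe : ∀ x, c ≤ x → x ≤ d → ‖F x - F (e x)‖ ≤ κ * n x := by
    intro x hcx hxd
    have h1 := he_mem x hcx
    have h2 : dist x (e x) = n x := by
      rw [Subtype.dist_eq, Real.dist_eq, abs_of_nonneg]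
      exact sub_nonneg.2 h1.2
    rw [← h2]
    refine hLip _ h1.1 x ?_
    rw [h2]
    have h3 : (c : ℝ) ≤ e x := he_le hc hcx
    have h4 : (x : ℝ) ≤ d := hxd
    simp only [hn]
    linarith
  set A : I → ℝ := fun x => κ * (2 * m x - n x) with hA
  have hec : e c = c := le_antisymm (he_mem c le_rfl).2 (he_le hc le_rfl)
  refine le_of_forall_pos_le_add fun ε' hε' => ?_
  obtain ⟨δ1, hδ1, h1⟩ := h ε' hε'
  have hloc : ∀ t : I, ∃ r > 0, t ∉ E → Metric.ball t r ⊆ Eᶜ := by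
    intro t
    by_cases ht : t ∈ E
    · exact ⟨1, one_pos, fun h => absurd ht h⟩
    · obtain ⟨r, hr, h⟩ := Metric.isOpen_iff.1 hE.isOpen_compl t ht
      exact ⟨r, hr, fun _ => h⟩
  choose δ2 hδ2 h2 using hloc
  obtain ⟨L, hL, hLp, hLf⟩ := exists_tiles (isGauge_min hδ1 hδ2) hcd
  have hf1 : IsFine δ1 L := hLf.mono fun t => min_le_left _ _
  have hf2 : IsFine δ2 L := hLf.mono fun t => min_le_right _ _
  have hpt : ∀ p ∈ L, ‖p.1.increment (F ∘ e) - if p.2 ∈ E then p.1.increment F else 0‖ ≤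
      p.1.increment A := by
    intro p hp
    obtain ⟨hcx, hzd⟩ := hL.bounds p hp
    have hxz := p.1.fst_le_snd
    have hcz := hcx.trans hxz
    have hxd := hxz.trans hzd
    have hAeq : p.1.increment A = κ * (n p.1.fst - n p.1.snd +
        2 * volume.real (Ioc p.1.fst p.1.snd \ E)) := by
      rw [← hm_sub hxz]
      simp only [ClosedSubinterval.increment, hA]
      ring
    rw [hAeq]
    split_ifs with ht
    · have hnz : n p.1.snd ≤ volume.real (Ioc p.1.fst p.1.snd \ E) := by
        have h3 : p.1.fst ≤ e p.1.snd := (hLp p hp).1.trans (he_le ht (hLp p hp).2)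
        have h4 := he_mem p.1.snd hcz
        rw [hn]
        show ((p.1.snd : I) : ℝ) - e p.1.snd ≤ _
        rw [← hlen h4.2]
        refine measureReal_mono fun w hw => ⟨⟨h3.trans_lt hw.1, hw.2⟩, fun hwE => ?_⟩
        exact absurd (he_le hwE hw.2) (not_le.2 hw.1)
      have h5 : p.1.increment (F ∘ e) - p.1.increment F =
          (F p.1.fst - F (e p.1.fst)) - (F p.1.snd - F (e p.1.snd)) := by
        simp only [ClosedSubinterval.increment, Function.comp_apply]
        abel
      rw [h5]
      refine (norm_sub_le _ _).trans ?_
      have h6 := hFe _ hcx hxd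
      have h7 := hFe _ hcz hzd
      nlinarith
    · have hsub := (hf2 p hp).trans (h2 _ ht)
      have he_eq : e p.1.snd = e p.1.fst := by
        have h4 := he_mem p.1.snd hcz
        have h5 : e p.1.snd ≤ p.1.fst := by
          by_contra hlt
          exact hsub ⟨(not_le.1 hlt).le, h4.2⟩ h4.1
        refine le_antisymm (he_le h4.1 h5) ?_
        have h6 := he_mem p.1.fst hcx
        exact he_le h6.1 (h6.2.trans hxz)
      have hvol : volume.real (Ioc p.1.fst p.1.snd \ E) = (p.1.snd : ℝ) - p.1.fst := by
        rw [← hlen hxz]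
        congr 1
        exact sdiff_eq_left.2 (Set.disjoint_left.2 fun w hw => hsub (Ioc_subset_Icc_self hw))
      have h0 : (0 : ℝ) ≤ (p.1.snd : ℝ) - p.1.fst := sub_nonneg.2 hxz
      rw [hvol]
      simp only [ClosedSubinterval.increment, Function.comp_apply, he_eq, hn, sub_self, norm_zero]
      exact mul_nonneg hκ (by linarith)
  set T := L.filter fun p => p.2 ∈ E with hT
  have hTsum : (L.map fun p => if p.2 ∈ E then p.1.increment F else 0).sum =
      (T.map (defect F g)).sum + riemannSum g T := by
    rw [sum_defect, sub_add_cancel, hT, sum_map_filter]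
  have hTdef : ‖(T.map (defect F g)).sum‖ ≤ ε' := h1 T (hL.nonOverlapping.filter _) (hf1.filter _)
  have hTrie : ‖riemannSum g T‖ ≤ ε * ((d : ℝ) - c) := by
    have hε : 0 ≤ ε := (norm_nonneg _).trans (hg c hc)
    have h3 : (T.map fun p => p.1.length).sum ≤ (d : ℝ) - c := by
      have h4 := (hL.nonOverlapping.filter fun p => p.2 ∈ E).sum_length_le (U := Icc c d)
        fun p hp => by
          have := hL.bounds p (List.mem_of_mem_filter hp)
          exact Ioo_subset_Icc_self.trans (Icc_subset_Icc this.1 this.2)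
      rwa [measureReal_def, unitInterval.volume_Icc, ENNReal.toReal_ofReal (sub_nonneg.2 hcd)]
        at h4
    refine (norm_sum_map_le _ _).trans (le_trans ?_ (mul_le_mul_of_nonneg_left h3 hε))
    rw [← List.sum_map_mul_left]
    refine List.sum_le_sum fun p hp => ?_
    rw [norm_smul, Real.norm_eq_abs, abs_of_nonneg p.1.length_nonneg, mul_comm]
    refine mul_le_mul_of_nonneg_right (hg _ ?_) p.1.length_nonneg
    simpa using (List.mem_filter.1 hp).2
  have hmain : ‖F (e d) - F (e c) - ((T.map (defect F g)).sum + riemannSum g T)‖ ≤ A d - A c := by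
    rw [← hTsum, ← hL.sum_increment hcd A]
    have h3 := hL.sum_increment hcd (F ∘ e)
    simp only [Function.comp_apply] at h3
    rw [← h3, ← sum_map_sub]
    exact (norm_sum_map_le _ _).trans (List.sum_le_sum hpt)
  have hd := hFe d hcd le_rfl
  have hAdc : A d - A c = κ * (2 * volume.real (Ioc c d \ E) - n d) := by
    have : n c = 0 := by simp [hn, hec]
    rw [← hm_sub hcd]
    simp only [hA, this]
    ring
  rw [hAdc, hec] at hmain
  have hdec : F d - F c = (F d - F (e d)) +
      (F (e d) - F c - ((T.map (defect F g)).sum + riemannSum g T)) +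
      ((T.map (defect F g)).sum + riemannSum g T) := by abel
  rw [hdec]
  refine (norm_add_le _ _).trans ?_
  have h8 := norm_add_le (F d - F (e d))
    (F (e d) - F c - ((T.map (defect F g)).sum + riemannSum g T))
  have h9 := norm_add_le (T.map (defect F g)).sum (riemannSum g T)
  linarith

theorem SaksHenstock.norm_sub_le_of_mem {F g : I → Y} (h : SaksHenstock F g) {E : Set I}
    (hE : IsClosed E) {r κ ε : ℝ} (hκ : 0 ≤ κ)
    (hLip : ∀ t ∈ E, ∀ t' : I, dist t' t < r → ‖F t' - F t‖ ≤ κ * dist t' t)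
    (hg : ∀ t ∈ E, ‖g t‖ ≤ ε) {t t' : I} (ht : t ∈ E) (hr : dist t' t < r) :
    ‖F t' - F t‖ ≤ ε * dist t' t + 3 * κ * volume.real (uIoc t t' \ E) := by
  have hε : 0 ≤ ε := (norm_nonneg _).trans (hg t ht)
  rcases le_total t t' with htt | htt
  · have hd : dist t' t = (t' : ℝ) - t := by
      rw [Subtype.dist_eq, Real.dist_eq, abs_of_nonneg (sub_nonneg.2 (Subtype.coe_le_coe.2 htt))]
    rw [uIoc_of_le htt, hd]
    have := h.norm_sub_le_of_left_mem hE hκ hLip hg ht htt (hd ▸ hr)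
    have h0 : 0 ≤ κ * volume.real (Ioc t t' \ E) := mul_nonneg hκ measureReal_nonneg
    linarith
  · have hd : dist t' t = (t : ℝ) - t' := by
      rw [dist_comm, Subtype.dist_eq, Real.dist_eq,
        abs_of_nonneg (sub_nonneg.2 (Subtype.coe_le_coe.2 htt))]
    -- The first point of `E` after `t'`.
    set e := sInf (E ∩ Icc t' t) with he
    have hemem : e ∈ E ∩ Icc t' t :=
      (hE.inter isClosed_Icc).isCompact.sInf_mem ⟨t, ht, htt, le_rfl⟩
    have h1 : (t' : ℝ) ≤ e := hemem.2.1
    have h2 : (e : ℝ) ≤ t := hemem.2.2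
    have hd' : dist t' e = (e : ℝ) - t' := by
      rw [dist_comm, Subtype.dist_eq, Real.dist_eq, abs_of_nonneg (sub_nonneg.2 h1)]
    have h3 := h.norm_sub_le_of_left_mem hE hκ hLip hg hemem.1 hemem.2.2 (by linarith)
    have h4 := hLip e hemem.1 t' (by linarith)
    rw [uIoc_of_ge htt, hd]
    have h5 : (e : ℝ) - t' ≤ volume.real (Ioc t' t \ E) := by
      have : volume.real (Ioo t' e) = (e : ℝ) - t' := by
        rw [measureReal_def, unitInterval.volume_Ioo, ENNReal.toReal_ofReal (sub_nonneg.2 h1)]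
      rw [← this]
      refine measureReal_mono fun w hw => ⟨⟨hw.1, hw.2.le.trans hemem.2.2⟩, fun hwE => ?_⟩
      have hwm : w ∈ E ∩ Icc t' t := ⟨hwE, hw.1.le, hw.2.le.trans hemem.2.2⟩
      exact absurd (sInf_le hwm) (not_le.2 hw.2)
    have h6 : volume.real (Ioc e t \ E) ≤ volume.real (Ioc t' t \ E) :=
      measureReal_mono (sdiff_subset_sdiff_left (Ioc_subset_Ioc_left hemem.2.1))
    rw [hd'] at h4
    have h7 := mul_le_mul_of_nonneg_left h5 hκ
    have h8 := mul_le_mul_of_nonneg_left h6 hκ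
    have h9 : ε * ((t : ℝ) - e) ≤ ε * ((t : ℝ) - t') :=
      mul_le_mul_of_nonneg_left (by linarith) hε
    calc ‖F t' - F t‖ = ‖(F t' - F e) - (F t - F e)‖ := by congr 1; abel
      _ ≤ ‖F t' - F e‖ + ‖F t - F e‖ := norm_sub_le _ _
      _ ≤ _ := by linarith

/-- A strongly measurable McShane integrable function whose primitive has null variation is almost
everywhere the derivative of its primitive. Measurability is used in the form that countably many
measurable sets of small oscillation of `g` cover almost all of `[0,1]`. -/
theorem SaksHenstock.ae_hasIntervalDeriv {F g : I → Y} (h : SaksHenstock F g)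
    (hV : NullVariation F) (hM : ∀ ε > 0, ∃ D : Set Y, D.Countable ∧
      (∀ y ∈ D, NullMeasurableSet {t | ‖g t - y‖ ≤ ε} (volume : Measure I)) ∧
      ∀ᵐ t : I, ∃ y ∈ D, ‖g t - y‖ ≤ ε) :
    ∀ᵐ t : I, HasIntervalDeriv F (g t) t := by
  have key : ∀ ε > 0, ∀ᵐ t : I, ∃ η > 0, ∀ t' : I, dist t' t < η →
      ‖F t' - F t - ((t' : ℝ) - t) • g t‖ ≤ 3 * ε * dist t' t := by
    intro ε hε
    obtain ⟨D, hDc, hDm, hDae⟩ := hM ε hε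
    have hyk : ∀ y ∈ D, ∀ k : ℕ, ∀ᵐ t : I, t ∈ lipschitzPoints F k ∩ {t | ‖g t - y‖ ≤ ε} →
        ∃ η > 0, ∀ t' : I, dist t' t < η →
          ‖F t' - F t - ((t' : ℝ) - t) • g t‖ ≤ 3 * ε * dist t' t := by
      intro y hy k
      refine ae_of_forall_closed_subset
        ((isClosed_lipschitzPoints h.continuous k).nullMeasurableSet.inter (hDm y hy))
        fun E hEM hE => ?_
      filter_upwards [ae_density hE] with t ht htE
      set κ : ℝ := k + 1 + ‖y‖ with hκ
      have hκ0 : 0 < κ := by positivity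
      obtain ⟨η, hη, hη'⟩ := ht htE (ε / (3 * κ)) (by positivity)
      have hk : (0 : ℝ) < 1 / ((k : ℝ) + 1) := by positivity
      refine ⟨min η (1 / ((k : ℝ) + 1)), lt_min hη hk, fun t' ht' => ?_⟩
      have h1 := (h.sub_const y).norm_sub_le_of_mem hE (r := 1 / ((k : ℝ) + 1)) (κ := κ) (ε := ε)
        hκ0.le (fun s hs s' hs' => ?_) (fun s hs => (hEM hs).2) htE
        (ht'.trans_le (min_le_right _ _))
      · have h2 := hη' t' (ht'.trans_le (min_le_left _ _))
        have h3 : 3 * κ * volume.real (uIoc t t' \ E) ≤ ε * dist t' t := by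
          calc 3 * κ * volume.real (uIoc t t' \ E) ≤ 3 * κ * (ε / (3 * κ) * dist t' t) := by gcongr
            _ = ε * dist t' t := by field_simp
        have h4 : ‖((t' : ℝ) - t) • (g t - y)‖ ≤ ε * dist t' t := by
          have h5 : ‖g t - y‖ ≤ ε := (hEM htE).2
          rw [norm_smul, mul_comm, ← dist_eq_norm (t' : ℝ) t]
          exact mul_le_mul_of_nonneg_right h5 dist_nonneg
        calc ‖F t' - F t - ((t' : ℝ) - t) • g t‖
            = ‖(F t' - (t' : ℝ) • y - (F t - (t : ℝ) • y)) - ((t' : ℝ) - t) • (g t - y)‖ := by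
              congr 1; module
          _ ≤ _ := (norm_sub_le _ _).trans (by linarith)
      · have h2 := (hEM hs).1 s' hs'
        calc ‖F s' - (s' : ℝ) • y - (F s - (s : ℝ) • y)‖
            = ‖(F s' - F s) - ((s' : ℝ) - s) • y‖ := by congr 1; module
          _ ≤ ‖F s' - F s‖ + ‖((s' : ℝ) - s) • y‖ := norm_sub_le _ _
          _ ≤ κ * dist s' s := by
            rw [norm_smul, ← dist_eq_norm (s' : ℝ) s, hκ, ← Subtype.dist_eq]
            linarith
    have hall : ∀ᵐ t : I, ∀ y ∈ D, ∀ k : ℕ, t ∈ lipschitzPoints F k ∩ {t | ‖g t - y‖ ≤ ε} →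
        ∃ η > 0, ∀ t' : I, dist t' t < η →
          ‖F t' - F t - ((t' : ℝ) - t) • g t‖ ≤ 3 * ε * dist t' t :=
      (ae_ball_iff hDc).2 fun y hy => ae_all_iff.2 (hyk y hy)
    filter_upwards [hall, hDae, hV.ae_exists_mem_lipschitzPoints] with t h1 h2 h3
    obtain ⟨y, hy, hgy⟩ := h2
    obtain ⟨k, hk⟩ := h3
    exact h1 y hy k ⟨hk, hgy⟩
  have hall : ∀ᵐ t : I, ∀ j : ℕ, ∃ η > 0, ∀ t' : I, dist t' t < η →
      ‖F t' - F t - ((t' : ℝ) - t) • g t‖ ≤ 3 * (1 / ((j : ℝ) + 1)) * dist t' t :=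
    ae_all_iff.2 fun j => key _ (by positivity)
  filter_upwards [hall] with t ht ε hε
  obtain ⟨j, hj⟩ := exists_nat_one_div_lt (show 0 < ε / 3 by positivity)
  obtain ⟨η, hη, h'⟩ := ht j
  exact ⟨η, hη, fun t' ht' => (h' t' ht').trans
    (mul_le_mul_of_nonneg_right (by linarith) dist_nonneg)⟩

/-- A one-point estimate at the tag controls the defect of an interval that contains the tag. -/
theorem norm_defect_le_of_forall_dist_lt {F g : I → Y} {ε η : ℝ} {p : ClosedSubinterval × I}
    (h : ∀ t' : I, dist t' p.2 < η → ‖F t' - F p.2 - ((t' : ℝ) - p.2) • g p.2‖ ≤ ε * dist t' p.2)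
    (hp : p.2 ∈ (p.1 : Set I)) (hη : (p.1 : Set I) ⊆ Metric.ball p.2 η) :
    ‖defect F g p‖ ≤ ε * p.1.length := by
  obtain ⟨hl, hr⟩ := hp
  have hl' : (p.1.fst : ℝ) ≤ p.2 := hl
  have hr' : (p.2 : ℝ) ≤ p.1.snd := hr
  have a1 := h p.1.fst (hη ⟨le_rfl, p.1.fst_le_snd⟩)
  have a2 := h p.1.snd (hη ⟨p.1.fst_le_snd, le_rfl⟩)
  have d1 : dist p.1.fst p.2 = (p.2 : ℝ) - p.1.fst := by
    rw [dist_comm, Subtype.dist_eq, Real.dist_eq, abs_of_nonneg (sub_nonneg.2 hl')]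
  have d2 : dist p.1.snd p.2 = (p.1.snd : ℝ) - p.2 := by
    rw [Subtype.dist_eq, Real.dist_eq, abs_of_nonneg (sub_nonneg.2 hr')]
  rw [d1] at a1
  rw [d2] at a2
  have hdec : defect F g p = (F p.1.snd - F p.2 - ((p.1.snd : ℝ) - p.2) • g p.2) -
      (F p.1.fst - F p.2 - ((p.1.fst : ℝ) - p.2) • g p.2) := by
    simp only [defect, ClosedSubinterval.increment, ClosedSubinterval.length]
    module
  rw [hdec]
  refine (norm_sub_le _ _).trans ?_
  simp only [ClosedSubinterval.length]
  linarith

/-- A function with null variation which is almost everywhere differentiable is a variational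
Henstock primitive of its derivative. -/
theorem NullVariation.variationalHenstock {F g : I → Y} (hV : NullVariation F)
    (h : ∀ᵐ t : I, HasIntervalDeriv F (g t) t) : VariationalHenstock F g := by
  classical
  intro ε hε
  have hε3 : 0 < ε / 3 := by positivity
  set N : Set I := {t | ¬ HasIntervalDeriv F (g t) t} with hNdef
  have hN : volume N = 0 := h
  obtain ⟨δ1, hδ1, h1⟩ := hV N hN _ hε3
  obtain ⟨δ2, hδ2, h2⟩ := exists_gauge_sum_le_of_null hN (fun t => ‖g t‖) hε3
  have hloc : ∀ t : I, ∃ η > 0, t ∉ N → ∀ t' : I, dist t' t < η →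
      ‖F t' - F t - ((t' : ℝ) - t) • g t‖ ≤ ε / 3 * dist t' t := by
    intro t
    by_cases ht : t ∈ N
    · exact ⟨1, one_pos, fun h => absurd ht h⟩
    · obtain ⟨η, hη, h'⟩ := not_not.1 ht (ε / 3) hε3
      exact ⟨η, hη, fun _ => h'⟩
  choose δ3 hδ3 h3 using hloc
  refine ⟨_, isGauge_min hδ1 (isGauge_min hδ2 hδ3), fun L hL hLp hLf => ?_⟩
  have hf1 : IsFine δ1 L := hLf.mono fun t => min_le_left _ _
  have hf2 : IsFine δ2 L := hLf.mono fun t => (min_le_right _ _).trans (min_le_left _ _)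
  have hf3 : IsFine δ3 L := hLf.mono fun t => (min_le_right _ _).trans (min_le_right _ _)
  have hmemN : ∀ p ∈ L.filter fun p => p.2 ∈ N, p.2 ∈ N := fun p hp => by
    simpa using (List.mem_filter.1 hp).2
  have e1 := h1 _ (hL.filter fun p => p.2 ∈ N) (hLp.filter _) (hf1.filter _) hmemN
  have e2 := h2 _ (hL.filter fun p => p.2 ∈ N) (hf2.filter _) hmemN
  rw [sum_map_filter] at e1 e2
  have e3 := mul_le_mul_of_nonneg_left hL.sum_length_le_one hε3.le
  rw [← List.sum_map_mul_left] at e3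
  have hpt : ∀ p ∈ L, ‖defect F g p‖ ≤ (if p.2 ∈ N then ‖p.1.increment F‖ else 0) +
      (if p.2 ∈ N then p.1.length * ‖g p.2‖ else 0) + ε / 3 * p.1.length := by
    intro p hp
    have h0 := p.1.length_nonneg
    split_ifs with ht
    · refine (norm_sub_le _ _).trans ?_
      rw [norm_smul, Real.norm_eq_abs, abs_of_nonneg h0]
      have := mul_nonneg hε3.le h0
      linarith
    · rw [zero_add, zero_add]
      exact norm_defect_le_of_forall_dist_lt (h3 _ ht) (hLp p hp) (hf3 p hp)
  refine (List.sum_le_sum hpt).trans ?_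
  rw [List.sum_map_add, List.sum_map_add]
  linarith

end

end TaggedList

/-! ### Weakly compact convex sets and their support functions -/

section WeakTopology

variable {X : Type*} [NormedAddCommGroup X] [NormedSpace ℝ X]

theorem tendsto_toWeakSpace_iff {α : Type*} {l : Filter α} {φ : α → X} {x : X} :
    Tendsto (fun a => toWeakSpace ℝ X (φ a)) l (𝓝 (toWeakSpace ℝ X x)) ↔
      ∀ f : StrongDual ℝ X, Tendsto (fun a => f (φ a)) l (𝓝 (f x)) := by
  refine WeakBilin.tendsto_iff_forall_eval_tendsto (topDualPairing ℝ X).flip fun y z h => ?_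
  by_contra hne
  obtain ⟨f, hf⟩ := SeparatingDual.exists_separating_of_ne (R := ℝ) hne
  exact hf (DFunLike.congr_fun h f)

end WeakTopology

namespace CWK

variable {X : Type*} [NormedAddCommGroup X] [NormedSpace ℝ X]

theorem isCompact_image (A : CWK X) (f : StrongDual ℝ X) :
    IsCompact ((fun x => f x) '' (A : Set X)) := by
  have h := A.2.2.2.image (WeakBilin.eval_continuous (topDualPairing ℝ X).flip f)
  convert h using 1
  ext y
  constructor
  · rintro ⟨x, hx, rfl⟩
    exact ⟨_, ⟨x, hx, rfl⟩, rfl⟩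
  · rintro ⟨_, ⟨x, hx, rfl⟩, rfl⟩
    exact ⟨x, hx, rfl⟩

theorem isClosed (A : CWK X) : IsClosed (A : Set X) := by
  have h := A.2.2.2.isClosed.preimage (toWeakSpaceCLM ℝ X).continuous
  have heq : toWeakSpaceCLM ℝ X ⁻¹' (toWeakSpace ℝ X '' (A : Set X)) = A := by
    ext x
    constructor
    · rintro ⟨y, hy, hyx⟩
      exact (toWeakSpace ℝ X).injective hyx ▸ hy
    · exact fun hx => ⟨x, hx, rfl⟩
  rwa [heq] at h

/-- Weakly compact sets are bounded, by the uniform boundedness principle. -/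
theorem exists_norm_le (A : CWK X) : ∃ R, ∀ x ∈ (A : Set X), ‖x‖ ≤ R := by
  obtain ⟨R, hR⟩ := banach_steinhaus
    (g := fun x : (A : Set X) => NormedSpace.inclusionInDoubleDual ℝ X x) fun f => by
      obtain ⟨C, hC⟩ := (A.isCompact_image f).isBounded.exists_norm_le
      exact ⟨C, fun x => hC _ ⟨x, x.2, rfl⟩⟩
  refine ⟨R, fun x hx => ?_⟩
  have h : ‖NormedSpace.inclusionInDoubleDualLi (E := X) ℝ x‖ ≤ R := hR ⟨x, hx⟩
  rwa [LinearIsometry.norm_map] at h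

theorem isBounded (A : CWK X) : Bornology.IsBounded (A : Set X) :=
  isBounded_iff_forall_norm_le.2 A.exists_norm_le

theorem hausdorffEDist_ne_top (A B : CWK X) :
    Metric.hausdorffEDist (A : Set X) B ≠ ⊤ :=
  Metric.hausdorffEDist_ne_top_of_nonempty_of_bounded A.2.1 B.2.1 A.isBounded B.isBounded

/-- The singleton `{0}`. -/
def zero (X : Type*) [NormedAddCommGroup X] [NormedSpace ℝ X] : CWK X :=
  ⟨{0}, singleton_nonempty 0, convex_singleton 0, by simp⟩

/-- The Minkowski sum. -/
def add (A B : CWK X) : CWK X :=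
  ⟨(A : Set X) + B, A.2.1.add B.2.1, A.2.2.1.add B.2.2.1, by
    rw [image_add]
    exact A.2.2.2.add B.2.2.2⟩

/-- The multiplication by scalars. -/
def smul (r : ℝ) (A : CWK X) : CWK X :=
  ⟨r • (A : Set X), A.2.1.smul_set, A.2.2.1.smul r, by
    rw [image_smul_set]
    exact A.2.2.2.smul r⟩

/-- The value `sup_{x ∈ A} f(x)` of the support function of `A`. -/
noncomputable def support (A : CWK X) (f : StrongDual ℝ X) : ℝ :=
  sSup ((fun x => f x) '' (A : Set X))

theorem le_support (A : CWK X) (f : StrongDual ℝ X) {x : X} (hx : x ∈ (A : Set X)) :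
    f x ≤ A.support f :=
  le_csSup (A.isCompact_image f).bddAbove ⟨x, hx, rfl⟩

theorem support_le (A : CWK X) (f : StrongDual ℝ X) {c : ℝ} (h : ∀ x ∈ (A : Set X), f x ≤ c) :
    A.support f ≤ c := by
  refine csSup_le (A.2.1.image _) ?_
  rintro _ ⟨x, hx, rfl⟩
  exact h x hx

theorem exists_eq_support (A : CWK X) (f : StrongDual ℝ X) :
    ∃ x ∈ (A : Set X), f x = A.support f :=
  (A.isCompact_image f).sSup_mem (A.2.1.image _)

theorem support_add (A B : CWK X) (f : StrongDual ℝ X) :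
    (A.add B).support f = A.support f + B.support f := by
  refine le_antisymm (support_le _ _ ?_) ?_
  · rintro _ ⟨a, ha, b, hb, rfl⟩
    show f (a + b) ≤ _
    rw [map_add]
    exact add_le_add (A.le_support f ha) (B.le_support f hb)
  · obtain ⟨a, ha, ha'⟩ := A.exists_eq_support f
    obtain ⟨b, hb, hb'⟩ := B.exists_eq_support f
    rw [← ha', ← hb', ← map_add]
    exact le_support _ f (add_mem_add ha hb)

theorem support_smul {r : ℝ} (hr : 0 ≤ r) (A : CWK X) (f : StrongDual ℝ X) :
    (A.smul r).support f = r * A.support f := by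
  refine le_antisymm (support_le _ _ ?_) ?_
  · rintro _ ⟨a, ha, rfl⟩
    show f (r • a) ≤ _
    rw [map_smul, smul_eq_mul]
    exact mul_le_mul_of_nonneg_left (A.le_support f ha) hr
  · obtain ⟨a, ha, ha'⟩ := A.exists_eq_support f
    rw [← ha', ← smul_eq_mul, ← map_smul]
    exact le_support _ f (smul_mem_smul_set ha)

/-- The Banach space of bounded functions on the dual unit ball, in which `CWK X` is embedded. -/
abbrev SupportSpace (X : Type*) [NormedAddCommGroup X] [NormedSpace ℝ X] : Type _ :=
  lp (fun _ : {f : StrongDual ℝ X // ‖f‖ ≤ 1} => ℝ) ∞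

/-- The **Rådström embedding**, which maps a set to its support function on the dual unit ball. -/
noncomputable def embed (A : CWK X) : SupportSpace X :=
  ⟨fun f => A.support f.1, memℓp_infty (by
    obtain ⟨R, hR⟩ := A.exists_norm_le
    refine ⟨R, ?_⟩
    rintro _ ⟨f, rfl⟩
    obtain ⟨x, hx, hx'⟩ := A.exists_eq_support f.1
    show ‖A.support f.1‖ ≤ R
    rw [← hx']
    refine (f.1.le_opNorm x).trans ?_
    exact (mul_le_of_le_one_left (norm_nonneg _) f.2).trans (hR x hx))⟩

theorem embed_add (A B : CWK X) : embed (A.add B) = embed A + embed B := by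
  ext f
  exact support_add A B f.1

theorem embed_smul {r : ℝ} (hr : 0 ≤ r) (A : CWK X) : embed (A.smul r) = r • embed A := by
  ext f
  exact support_smul hr A f.1

theorem embed_zero : embed (zero X) = 0 := by
  ext f
  show (zero X).support f.1 = 0
  obtain ⟨x, hx, hx'⟩ := (zero X).exists_eq_support f.1
  rw [← hx', mem_singleton_iff.1 hx, map_zero]

theorem support_le_of_hausdorffEDist_lt {A B : CWK X} {r : ℝ}
    (h : Metric.hausdorffEDist (A : Set X) B < ENNReal.ofReal r) {f : StrongDual ℝ X}
    (hf : ‖f‖ ≤ 1) : A.support f ≤ B.support f + r := by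
  refine support_le _ _ fun x hx => ?_
  obtain ⟨y, hy, hxy⟩ := Metric.exists_edist_lt_of_hausdorffEDist_lt hx h
  rw [edist_dist] at hxy
  have hxy' : dist x y < r := (ENNReal.ofReal_lt_ofReal_iff_of_nonneg dist_nonneg).1 hxy
  have h1 : f x - f y ≤ r := by
    rw [← map_sub]
    refine (le_abs_self _).trans ((f.le_opNorm _).trans ?_)
    refine (mul_le_of_le_one_left (norm_nonneg _) hf).trans ?_
    rw [← dist_eq_norm]
    exact hxy'.le
  linarith [B.le_support f hy]

/-- By the Hahn–Banach theorem, the support function determines the distance to a convex set. -/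
theorem infEDist_le_of_support_lt {A B : CWK X} {r : ℝ} (hr : 0 < r)
    (h : ∀ f : StrongDual ℝ X, ‖f‖ ≤ 1 → A.support f < B.support f + r) {a : X}
    (ha : a ∈ (A : Set X)) : Metric.infEDist a (B : Set X) ≤ ENNReal.ofReal r := by
  by_contra hlt
  have hdisj : Disjoint (Metric.ball a r) (B : Set X) := by
    refine Set.disjoint_left.2 fun b hb hbB => ?_
    refine hlt ((Metric.infEDist_le_edist_of_mem hbB).trans ?_)
    rw [edist_dist, dist_comm]
    exact ENNReal.ofReal_le_ofReal (Metric.mem_ball.1 hb).le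
  obtain ⟨f, u, hfa, hfB⟩ := geometric_hahn_banach_open (convex_ball a r) Metric.isOpen_ball
    B.2.2.1 hdisj
  have hau : f a < u := hfa a (Metric.mem_ball_self hr)
  have hnorm : ‖f‖ ≤ (u - f a) / r := by
    have hpos : 0 ≤ (u - f a) / r := div_nonneg (by linarith) hr.le
    have hunit : ∀ v : X, ‖v‖ = 1 → f v ≤ (u - f a) / r := by
      intro v hv
      rw [le_div_iff₀ hr]
      by_contra hlt'
      have hv0 : 0 < f v := by
        by_contra h0
        have := mul_nonpos_of_nonpos_of_nonneg (not_lt.1 h0) hr.le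
        linarith [not_le.1 hlt']
      have hs : a + ((u - f a) / f v) • v ∈ Metric.ball a r := by
        rw [mem_ball_iff_norm, add_sub_cancel_left, norm_smul, hv, mul_one, Real.norm_eq_abs,
          abs_of_nonneg (div_nonneg (by linarith) hv0.le), div_lt_iff₀ hv0, mul_comm]
        exact not_le.1 hlt'
      have := hfa _ hs
      rw [map_add, map_smul, smul_eq_mul, div_mul_cancel₀ _ hv0.ne'] at this
      linarith
    refine ContinuousLinearMap.opNorm_le_of_unit_norm hpos fun v hv => ?_
    rw [Real.norm_eq_abs, abs_le]
    have h1 := hunit (-v) (by rwa [norm_neg])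
    rw [map_neg] at h1
    exact ⟨by linarith, hunit v hv⟩
  have hf0 : 0 < ‖f‖ := by
    rw [norm_pos_iff]
    rintro rfl
    obtain ⟨b, hb⟩ := B.2.1
    have := hfB b hb
    simp only [zero_apply] at this hau
    linarith
  set g : StrongDual ℝ X := (-‖f‖⁻¹) • f with hg
  have hgn : ‖g‖ ≤ 1 := by
    rw [hg, norm_smul, norm_neg, norm_inv, norm_norm, inv_mul_cancel₀ hf0.ne']
  have h1 : g a ≤ A.support g := A.le_support g ha
  have h2 : B.support g ≤ -‖f‖⁻¹ * u := by
    refine support_le _ _ fun b hb => ?_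
    show -‖f‖⁻¹ * f b ≤ _
    have := mul_le_mul_of_nonneg_left (hfB b hb) (inv_nonneg.2 hf0.le)
    linarith
  have h3 : g a = -‖f‖⁻¹ * f a := rfl
  have h4 : r ≤ ‖f‖⁻¹ * (u - f a) := by
    rw [le_div_iff₀ hr] at hnorm
    rw [← div_eq_inv_mul, le_div_iff₀ hf0]
    linarith
  linarith [h g hgn]

/-- The Rådström embedding is isometric for the Hausdorff distance. -/
theorem edist_embed (A B : CWK X) :
    edist (embed A) (embed B) = Metric.hausdorffEDist (A : Set X) B := by
  have key : ∀ r : ℝ, 0 < r → ‖embed A - embed B‖ < r →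
      Metric.hausdorffEDist (A : Set X) B ≤ ENNReal.ofReal r := by
    intro r hr h
    have hd : ∀ f : StrongDual ℝ X, ‖f‖ ≤ 1 → |A.support f - B.support f| < r := by
      intro f hf
      exact (lp.norm_apply_le_norm ENNReal.top_ne_zero (embed A - embed B) ⟨f, hf⟩).trans_lt h
    refine Metric.hausdorffEDist_le_of_infEDist
      (fun a ha => infEDist_le_of_support_lt hr (fun f hf => ?_) ha)
      (fun b hb => infEDist_le_of_support_lt hr (fun f hf => ?_) hb)
    · linarith [(abs_lt.1 (hd f hf)).2]
    · linarith [(abs_lt.1 (hd f hf)).1]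
  rw [edist_dist, dist_eq_norm]
  refine le_antisymm ?_ ?_
  · refine le_of_forall_gt fun c hc => ?_
    obtain ⟨d, hd1, hd2⟩ := exists_between hc
    have hdtop : d ≠ ⊤ := (hd2.trans_le le_top).ne
    rw [← ENNReal.ofReal_toReal hdtop] at hd1 hd2
    refine lt_of_le_of_lt (ENNReal.ofReal_le_ofReal ?_) hd2
    refine lp.norm_le_of_forall_le ENNReal.toReal_nonneg fun f => ?_
    show |A.support f.1 - B.support f.1| ≤ _
    have h1 := support_le_of_hausdorffEDist_lt hd1 f.2
    rw [Metric.hausdorffEDist_comm] at hd1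
    have h2 := support_le_of_hausdorffEDist_lt hd1 f.2
    exact abs_le.2 ⟨by linarith, by linarith⟩
  · refine le_of_forall_gt fun c hc => ?_
    rcases eq_or_ne c ⊤ with rfl | hctop
    · exact (A.hausdorffEDist_ne_top B).lt_top
    obtain ⟨d, hd1, hd2⟩ := exists_between hc
    have hdtop : d ≠ ⊤ := (hd2.trans_le le_top).ne
    rw [← ENNReal.ofReal_toReal hdtop] at hd1 hd2
    have hd1' := (ENNReal.ofReal_lt_ofReal_iff_of_nonneg (norm_nonneg _)).1 hd1
    exact (key _ ((norm_nonneg _).trans_lt hd1') hd1').trans_lt hd2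

theorem embed_injective : Function.Injective (embed (X := X)) := by
  intro A B h
  have h1 := edist_embed A B
  rw [h, edist_self] at h1
  exact Subtype.ext ((A.isClosed.hausdorffEDist_zero_iff B.isClosed).1 h1.symm)

/-- A closed convex set which can be approximated by weakly compact convex sets is weakly compact:
the weak limit of an ultrafilter on the set is the norm limit of the weak limits of its
approximations. -/
theorem exists_coe_eq_of_approx [CompleteSpace X] {A : Set X} (hA : IsClosed A)
    (h : ∀ ε : ℝ, 0 < ε → ∃ K : CWK X, Metric.hausdorffEDist A K < ENNReal.ofReal ε) :
    ∃ B : CWK X, (B : Set X) = A := by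
  have hpos : ∀ n : ℕ, 0 < 1 / ((n : ℝ) + 1) := fun n => by positivity
  have hlim : Tendsto (fun n : ℕ => 1 / ((n : ℝ) + 1)) atTop (𝓝 0) :=
    tendsto_one_div_add_atTop_nhds_zero_nat
  choose K hK using fun n : ℕ => h _ (hpos n)
  have hAK : ∀ n, ∀ x ∈ A, ∃ y ∈ (K n : Set X), dist x y < 1 / ((n : ℝ) + 1) := by
    intro n x hx
    obtain ⟨y, hy, hxy⟩ := Metric.exists_edist_lt_of_hausdorffEDist_lt hx (hK n)
    rw [edist_dist] at hxy
    exact ⟨y, hy, (ENNReal.ofReal_lt_ofReal_iff_of_nonneg dist_nonneg).1 hxy⟩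
  have hKA : ∀ n, ∀ y ∈ (K n : Set X), ∃ x ∈ A, dist x y < 1 / ((n : ℝ) + 1) := by
    intro n y hy
    obtain ⟨x, hx, hxy⟩ := Metric.exists_edist_lt_of_hausdorffEDist_lt hy
      ((Metric.hausdorffEDist_comm).trans_lt (hK n))
    rw [edist_dist, dist_comm] at hxy
    exact ⟨x, hx, (ENNReal.ofReal_lt_ofReal_iff_of_nonneg dist_nonneg).1 hxy⟩
  have hne : A.Nonempty := by
    obtain ⟨y, hy⟩ := (K 0).2.1
    obtain ⟨x, hx, _⟩ := hKA 0 y hy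
    exact ⟨x, hx⟩
  have hmem : ∀ z, (∀ n : ℕ, ∃ x ∈ A, dist x z ≤ 2 * (1 / ((n : ℝ) + 1))) → z ∈ A := by
    intro z hz
    choose x hx hxz using hz
    refine hA.mem_of_tendsto (b := atTop) (f := x) ?_ (Eventually.of_forall hx)
    refine tendsto_iff_dist_tendsto_zero.2 ?_
    exact squeeze_zero (fun _ => dist_nonneg) hxz (by simpa using hlim.const_mul 2)
  have hconv : Convex ℝ A := by
    intro a ha b hb s t hs ht hst
    refine hmem _ fun n => ?_
    obtain ⟨a', ha', haa⟩ := hAK n a ha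
    obtain ⟨b', hb', hbb⟩ := hAK n b hb
    obtain ⟨x, hx, hxy⟩ := hKA n _ ((K n).2.2.1 ha' hb' hs ht hst)
    refine ⟨x, hx, (dist_triangle _ (s • a' + t • b') _).trans ?_⟩
    have h1 : dist (s • a' + t • b') (s • a + t • b) ≤ 1 / ((n : ℝ) + 1) := by
      refine (dist_add_add_le _ _ _ _).trans ?_
      rw [dist_smul₀, dist_smul₀, Real.norm_of_nonneg hs, Real.norm_of_nonneg ht,
        dist_comm a', dist_comm b']
      calc s * dist a a' + t * dist b b'
          ≤ s * (1 / ((n : ℝ) + 1)) + t * (1 / ((n : ℝ) + 1)) := by gcongr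
        _ = 1 / ((n : ℝ) + 1) := by rw [← add_mul, hst, one_mul]
    linarith
  refine ⟨⟨A, hne, hconv, isCompact_iff_ultrafilter_le_nhds.2 fun 𝒰 h𝒰 => ?_⟩, rfl⟩
  set 𝒱 : Ultrafilter X := 𝒰.map (toWeakSpace ℝ X).symm with h𝒱
  have hA𝒱 : A ∈ 𝒱 := by
    rw [h𝒱, Ultrafilter.mem_map]
    filter_upwards [le_principal_iff.1 h𝒰]
    rintro _ ⟨x, hx, rfl⟩
    show (toWeakSpace ℝ X).symm (toWeakSpace ℝ X x) ∈ A
    rwa [LinearEquiv.symm_apply_apply]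
  have hπ : ∀ n : ℕ, ∀ x, ∃ y, x ∈ A → y ∈ (K n : Set X) ∧ dist x y < 1 / ((n : ℝ) + 1) := by
    intro n x
    by_cases hx : x ∈ A
    · obtain ⟨y, hy⟩ := hAK n x hx
      exact ⟨y, fun _ => hy⟩
    · exact ⟨0, fun h => absurd h hx⟩
  choose π hπ using hπ
  have hk : ∀ n, ∃ k ∈ (K n : Set X), ∀ f : StrongDual ℝ X,
      Tendsto (fun x => f (π n x)) 𝒱 (𝓝 (f k)) := by
    intro n
    have hle : (𝒱.map fun x => toWeakSpace ℝ X (π n x) : Filter (WeakSpace ℝ X)) ≤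
        𝓟 (toWeakSpace ℝ X '' (K n : Set X)) := by
      rw [le_principal_iff, Ultrafilter.mem_coe, Ultrafilter.mem_map]
      filter_upwards [hA𝒱] with x hx
      exact ⟨π n x, (hπ n x hx).1, rfl⟩
    obtain ⟨_, ⟨k, hk, rfl⟩, hlim⟩ := isCompact_iff_ultrafilter_le_nhds.1 (K n).2.2.2 _ hle
    exact ⟨k, hk, tendsto_toWeakSpace_iff.1 hlim⟩
  choose k hkK hk using hk
  have hdist : ∀ n m, ‖k n - k m‖ ≤ 1 / ((n : ℝ) + 1) + 1 / ((m : ℝ) + 1) := by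
    intro n m
    refine NormedSpace.norm_le_dual_bound ℝ _ (by positivity) fun f => ?_
    have h1 : Tendsto (fun x => ‖f (π n x) - f (π m x)‖) 𝒱 (𝓝 ‖f (k n - k m)‖) := by
      rw [map_sub]
      exact ((hk n f).sub (hk m f)).norm
    refine le_of_tendsto h1 ?_
    filter_upwards [hA𝒱] with x hx
    rw [← map_sub, mul_comm]
    refine (f.le_opNorm _).trans (mul_le_mul_of_nonneg_left ?_ (norm_nonneg _))
    rw [← dist_eq_norm]
    refine (dist_triangle_left _ _ x).trans ?_
    exact add_le_add (hπ n x hx).2.le (hπ m x hx).2.le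
  have hcau : CauchySeq k := by
    refine cauchySeq_of_le_tendsto_0 (fun n : ℕ => 2 * (1 / ((n : ℝ) + 1))) ?_
      (by simpa using hlim.const_mul 2)
    intro n m N hn hm
    rw [dist_eq_norm]
    have h1 := Nat.one_div_le_one_div (α := ℝ) hn
    have h2 := Nat.one_div_le_one_div (α := ℝ) hm
    linarith [hdist n m]
  obtain ⟨z, hz⟩ := cauchySeq_tendsto_of_complete hcau
  have hzk : ∀ n, dist z (k n) ≤ 1 / ((n : ℝ) + 1) := by
    intro n
    have h1 : Tendsto (fun m : ℕ => 1 / ((m : ℝ) + 1) + 1 / ((n : ℝ) + 1)) atTop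
        (𝓝 (1 / ((n : ℝ) + 1))) := by simpa using hlim.add_const (1 / ((n : ℝ) + 1))
    refine le_of_tendsto_of_tendsto' (hz.dist tendsto_const_nhds) h1 fun m => ?_
    rw [dist_eq_norm]
    exact hdist m n
  have hzA : z ∈ A := by
    refine hmem z fun n => ?_
    obtain ⟨x, hx, hxk⟩ := hKA n _ (hkK n)
    refine ⟨x, hx, (dist_triangle_right _ _ (k n)).trans ?_⟩
    linarith [hzk n]
  refine ⟨toWeakSpace ℝ X z, ⟨z, hzA, rfl⟩, ?_⟩
  have hlimV : Tendsto (fun x => toWeakSpace ℝ X x) 𝒱 (𝓝 (toWeakSpace ℝ X z)) := by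
    refine tendsto_toWeakSpace_iff.2 fun f => Metric.tendsto_nhds.2 fun ε hε => ?_
    obtain ⟨n, hn⟩ := exists_nat_one_div_lt (show 0 < ε / (3 * (‖f‖ + 1)) by positivity)
    have hfn : ‖f‖ * (1 / ((n : ℝ) + 1)) < ε / 3 := by
      rw [lt_div_iff₀ (by positivity)] at hn
      have := hpos n
      nlinarith [norm_nonneg f]
    have hf : ∀ x y : X, dist x y ≤ 1 / ((n : ℝ) + 1) → dist (f x) (f y) < ε / 3 := by
      intro x y hxy
      rw [dist_eq_norm, ← map_sub]
      refine ((f.le_opNorm _).trans (mul_le_mul_of_nonneg_left ?_ (norm_nonneg _))).trans_lt hfn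
      rwa [← dist_eq_norm]
    filter_upwards [hA𝒱, Metric.tendsto_nhds.1 (hk n f) (ε / 3) (by positivity)] with x hx hx'
    have h1 := hf x (π n x) (hπ n x hx).2.le
    have h2 := hf z (k n) (hzk n)
    rw [dist_comm] at h2
    linarith [dist_triangle4 (f x) (f (π n x)) (f (k n)) (f z)]
  have hmap : (𝒱.map (toWeakSpace ℝ X) : Filter (WeakSpace ℝ X)) = 𝒰 := by
    rw [h𝒱, Ultrafilter.map_map]
    have : (toWeakSpace ℝ X : X → WeakSpace ℝ X) ∘ (toWeakSpace ℝ X).symm = id := by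
      funext x
      exact LinearEquiv.apply_symm_apply _ x
    rw [this, Ultrafilter.map_id]
  rw [← hmap]
  exact hlimV

/-- The range of the Rådström embedding is closed, since `CWK X` is complete. -/
theorem isClosed_range_embed [CompleteSpace X] : IsClosed (range (embed (X := X))) := by
  refine isClosed_of_closure_subset fun y hy => ?_
  obtain ⟨u, hu, huy⟩ := mem_closure_iff_seq_limit.1 hy
  choose K hK using hu
  set C : ℕ → TopologicalSpace.Closeds X := fun n => ⟨K n, (K n).isClosed⟩ with hC
  have hedist : ∀ n m, edist (C n) (C m) = edist (u n) (u m) := by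
    intro n m
    rw [TopologicalSpace.Closeds.edist_eq, ← hK, ← hK, edist_embed]
    rfl
  have hcau : CauchySeq C := by
    rw [EMetric.cauchySeq_iff]
    simp only [hedist]
    exact EMetric.cauchySeq_iff.1 huy.cauchySeq
  obtain ⟨A, hA⟩ := cauchySeq_tendsto_of_complete hcau
  rw [tendsto_iff_edist_tendsto_0] at hA
  obtain ⟨B, hB⟩ := exists_coe_eq_of_approx A.isClosed fun ε hε => by
    obtain ⟨n, hn⟩ := (hA.eventually (gt_mem_nhds (ENNReal.ofReal_pos.2 hε))).exists
    rw [edist_comm] at hn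
    exact ⟨K n, hn⟩
  refine ⟨B, tendsto_nhds_unique (tendsto_iff_edist_tendsto_0.2 ?_) huy⟩
  refine hA.congr fun n => ?_
  rw [← hK, edist_embed, hB]
  rfl

end CWK

/-! ### Integrals of multifunctions and integrals of their support functions -/

section Multifunctions

open TaggedList

variable {X : Type*} [NormedAddCommGroup X] [NormedSpace ℝ X]

namespace CWK

theorem ofReal_norm_embed_sub (A B : CWK X) :
    ENNReal.ofReal ‖embed A - embed B‖ = Metric.hausdorffEDist (A : Set X) B := by
  rw [← edist_embed, edist_dist, dist_eq_norm]

theorem ofReal_norm_embed (A : CWK X) :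
    ENNReal.ofReal ‖embed A‖ = Metric.hausdorffEDist (A : Set X) {0} := by
  have := ofReal_norm_embed_sub A (zero X)
  rwa [embed_zero, sub_zero] at this

/-- A Minkowski combination of weakly compact convex sets is a weakly compact convex set, and the
embedding respects it. -/
theorem exists_sum (G : I → CWK X) (P : TaggedFamily) : ∃ K : CWK X,
    (K : Set X) = ∑ p ∈ P, p.1.length • (G p.2 : Set X) ∧
      embed K = ∑ p ∈ P, p.1.length • embed (G p.2) := by
  classical
  induction P using Finset.induction_on with
  | empty => exact ⟨zero X, rfl, embed_zero⟩
  | insert p P hp ih =>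
    obtain ⟨K, hK, hK'⟩ := ih
    refine ⟨((G p.2).smul p.1.length).add K, ?_, ?_⟩
    · rw [Finset.sum_insert hp, ← hK]
      rfl
    · rw [Finset.sum_insert hp, ← hK', embed_add, embed_smul p.1.length_nonneg]

theorem riemannSum_mem_range (G : I → CWK X) (L : List (ClosedSubinterval × I)) :
    riemannSum (fun t => embed (G t)) L ∈ range (embed (X := X)) := by
  induction L with
  | nil => exact ⟨zero X, embed_zero⟩
  | cons p L ih =>
    obtain ⟨K, hK⟩ := ih
    refine ⟨((G p.2).smul p.1.length).add K, ?_⟩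
    rw [embed_add, embed_smul p.1.length_nonneg, hK]
    simp [riemannSum]

end CWK

open CWK

theorem riemannSum_toList {Y : Type*} [NormedAddCommGroup Y] [NormedSpace ℝ Y] (g : I → Y)
    (P : TaggedFamily) : riemannSum g P.toList = ∑ p ∈ P, p.1.length • g p.2 :=
  Finset.sum_map_toList P fun p => p.1.length • g p.2

theorem TaggedList.Tiles.sum_toFinset [DecidableEq (ClosedSubinterval × I)] {Y : Type*}
    [NormedAddCommGroup Y] [NormedSpace ℝ Y] (g : I → Y) {L : List (ClosedSubinterval × I)}
    (hL : Tiles 0 1 L) :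
    ∑ p ∈ (rightEnd :: L).toFinset, p.1.length • g p.2 = riemannSum g L := by
  rw [hL.nonOverlapping.rightEnd_cons.sum_toFinset fun p => p.1.length • g p.2]
  · simp [riemannSum, rightEnd, ClosedSubinterval.length]
  · intro p hp
    have : p.1.snd = p.1.fst := le_antisymm hp p.1.fst_le_snd
    simp [ClosedSubinterval.length, this]

/-- A multifunction has McShane integral `A` if and only if its support function has McShane
integral `embed A`. -/
theorem isMcShaneIntegral_coe_iff (G : I → CWK X) (A : CWK X) :
    IsMcShaneIntegral (fun t => (G t : Set X)) (A : Set X) ↔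
      HasMcShaneIntegral (fun t => embed (G t)) 0 1 (embed A) := by
  classical
  constructor
  · rintro ⟨-, -, -, h⟩ ε hε
    obtain ⟨δ, hδ, h'⟩ := h ε hε
    refine ⟨δ, hδ, fun L hL hLf => ?_⟩
    have h1 := h' _ hL.isPartitionOf fun p hp =>
      hLf.rightEnd_cons hδ p (List.mem_toFinset.1 hp)
    obtain ⟨K, hK, hK'⟩ := exists_sum G (rightEnd :: L).toFinset
    rw [← hK, ← ofReal_norm_embed_sub, hK', hL.sum_toFinset fun t => embed (G t),
      norm_sub_rev] at h1
    exact ((ENNReal.ofReal_lt_ofReal_iff_of_nonneg (norm_nonneg _)).1 h1).le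
  · intro h
    refine ⟨A.2.1, A.isClosed, A.2.2.1, fun ε hε => ?_⟩
    obtain ⟨δ, hδ, h'⟩ := h (ε / 2) (half_pos hε)
    refine ⟨δ, hδ, fun P hP hPf => ?_⟩
    have h1 := h' _ (tiles_toList hP) fun p hp => hPf p (Finset.mem_toList.1 hp)
    obtain ⟨K, hK, hK'⟩ := exists_sum G P
    rw [riemannSum_toList, ← hK', norm_sub_rev] at h1
    rw [← hK, ← ofReal_norm_embed_sub]
    exact (ENNReal.ofReal_lt_ofReal_iff hε).2 (h1.trans_lt (half_lt_self hε))

/-- The support functions of a McShane integrable multifunction have Cauchy Riemann sums. The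
integral of the multifunction is not assumed to be weakly compact here. -/
theorem McShaneIntegrable.riemannCauchy {Γ : I → CWK X} (h : McShaneIntegrable Γ) :
    RiemannCauchy fun t => embed (Γ t) := by
  classical
  obtain ⟨A, -, -, -, h⟩ := h
  intro ε hε
  obtain ⟨δ, hδ, h'⟩ := h (ε / 2) (half_pos hε)
  refine ⟨δ, hδ, fun L L' hL hL' hLf hLf' => ?_⟩
  have h1 := h' _ hL.isPartitionOf fun p hp => hLf.rightEnd_cons hδ p (List.mem_toFinset.1 hp)
  have h2 := h' _ hL'.isPartitionOf fun p hp => hLf'.rightEnd_cons hδ p (List.mem_toFinset.1 hp)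
  obtain ⟨K, hK, hKe⟩ := exists_sum Γ (rightEnd :: L).toFinset
  obtain ⟨K', hK', hKe'⟩ := exists_sum Γ (rightEnd :: L').toFinset
  rw [← hK, Metric.hausdorffEDist_comm] at h1
  rw [← hK'] at h2
  have h3 := Metric.hausdorffEDist_triangle.trans_lt (ENNReal.add_lt_add h1 h2)
  rw [← ENNReal.ofReal_add (half_pos hε).le (half_pos hε).le, add_halves,
    ← ofReal_norm_embed_sub, hKe, hKe', hL.sum_toFinset fun t => embed (Γ t),
    hL'.sum_toFinset fun t => embed (Γ t)] at h3
  exact ((ENNReal.ofReal_lt_ofReal_iff_of_nonneg (norm_nonneg _)).1 h3).le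

/-- A function `F` with values in the support space represents the McShane primitives of `Γ`. -/
theorem isMcShanePrimitive_iff {Γ : I → CWK X} {F : I → SupportSpace X}
    (h : SaksHenstock F fun t => embed (Γ t)) (Φ : ClosedSubinterval → CWK X) :
    IsMcShanePrimitive Γ Φ ↔ ∀ J, embed (Φ J) = J.increment F := by
  classical
  have key : ∀ J : ClosedSubinterval,
      IsMcShaneIntegral (restrictMulti Γ (J : Set I)) (Φ J : Set X) ↔
      HasMcShaneIntegral ((Icc J.fst J.snd).indicator fun t => embed (Γ t)) 0 1
        (embed (Φ J)) := by
    intro J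
    have e1 : restrictMulti Γ (J : Set I) =
        fun t => ((if t ∈ (J : Set I) then Γ t else zero X : CWK X) : Set X) := by
      funext t
      simp only [restrictMulti]
      split_ifs <;> rfl
    have e2 : ((Icc J.fst J.snd).indicator fun t => embed (Γ t)) =
        fun t => embed (if t ∈ (J : Set I) then Γ t else zero X) := by
      funext t
      by_cases ht : t ∈ (J : Set I)
      · rw [if_pos ht, indicator_of_mem (show t ∈ Icc J.fst J.snd from ht)]
      · rw [if_neg ht, indicator_of_notMem (show t ∉ Icc J.fst J.snd from ht), embed_zero]
    rw [e1, e2, isMcShaneIntegral_coe_iff]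
  refine forall_congr' fun J => (key J).trans ?_
  have hJ := h.hasMcShaneIntegral_indicator J.fst_le_snd
  exact ⟨fun h' => h'.unique zero_le_one hJ, fun h' => h'.symm ▸ hJ⟩

theorem HasMcShaneIntegral.mem_range_embed [CompleteSpace X] {G : I → CWK X} {a b : I}
    (hab : a ≤ b) {y : SupportSpace X} (h : HasMcShaneIntegral (fun t => embed (G t)) a b y) :
    y ∈ range (embed (X := X)) := by
  rw [← isClosed_range_embed.closure_eq]
  refine Metric.mem_closure_iff.2 fun ε hε => ?_
  obtain ⟨δ, hδ, h'⟩ := h (ε / 2) (half_pos hε)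
  obtain ⟨L, hL, -, hLf⟩ := exists_tiles hδ hab
  refine ⟨_, riemannSum_mem_range G L, ?_⟩
  rw [dist_comm, dist_eq_norm]
  exact (h' L hL hLf).trans_lt (half_lt_self hε)

/-! ### Variational measure and variational integrability -/

theorem sum_hausdorffEDist_eq (A B : ClosedSubinterval × I → CWK X) (P : TaggedFamily) :
    ∑ p ∈ P, Metric.hausdorffEDist (A p : Set X) (B p) =
      ENNReal.ofReal (P.toList.map fun p => ‖embed (A p) - embed (B p)‖).sum := by
  rw [Finset.sum_map_toList, ENNReal.ofReal_sum_of_nonneg fun _ _ => norm_nonneg _]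
  simp only [ofReal_norm_embed_sub]

theorem variationalMeasureContinuous_iff {Φ : ClosedSubinterval → CWK X}
    {F : I → SupportSpace X} (hF : ∀ J, embed (Φ J) = J.increment F) :
    VariationalMeasureContinuous Φ ↔ NullVariation F := by
  classical
  constructor
  · intro h N hN ε hε
    have hlt : variationalMeasure Φ N < ENNReal.ofReal ε := by
      rw [h N (NullMeasurableSet.of_null hN) hN]
      exact ENNReal.ofReal_pos.2 hε
    simp only [variationalMeasure, iInf_lt_iff] at hlt
    obtain ⟨δ, hδ, hlt⟩ := hlt
    refine ⟨δ, hδ, fun L hL hLp hLf hLN => ?_⟩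
    have h1 := (le_iSup₂ (f := fun (P : TaggedFamily) (_ : P.IsPartitionIn ∧ P.IsPerron ∧
        P.IsFine δ ∧ ∀ p ∈ P, p.2 ∈ N) => ∑ p ∈ P, Metric.hausdorffEDist (Φ p.1 : Set X) {0})
      L.toFinset ⟨fun p hp q hq hpq =>
          hL.of_mem_of_ne (List.mem_toFinset.1 hp) (List.mem_toFinset.1 hq) hpq,
        fun p hp => hLp p (List.mem_toFinset.1 hp), fun p hp => hLf p (List.mem_toFinset.1 hp),
        fun p hp => hLN p (List.mem_toFinset.1 hp)⟩).trans hlt.le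
    simp only [← ofReal_norm_embed, hF] at h1
    rw [← ENNReal.ofReal_sum_of_nonneg fun _ _ => norm_nonneg _,
      ENNReal.ofReal_le_ofReal_iff hε.le] at h1
    rwa [hL.sum_toFinset fun p => ‖p.1.increment F‖] at h1
    intro p hp
    have : p.1.snd = p.1.fst := le_antisymm hp p.1.fst_le_snd
    simp [ClosedSubinterval.increment, this]
  · intro h E _ hE
    refine le_antisymm (le_of_forall_gt fun c hc => ?_) zero_le
    obtain ⟨d, hd0, hdc⟩ := exists_between hc
    have hdtop : d ≠ ⊤ := (hdc.trans_le le_top).ne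
    obtain ⟨δ, hδ, h'⟩ := h E hE d.toReal (ENNReal.toReal_pos hd0.ne' hdtop)
    refine lt_of_le_of_lt (iInf₂_le_of_le δ hδ (iSup₂_le fun P hP => ?_)) hdc
    simp only [← ofReal_norm_embed, hF]
    rw [← ENNReal.ofReal_sum_of_nonneg fun _ _ => norm_nonneg _, ← Finset.sum_map_toList]
    refine (ENNReal.ofReal_le_ofReal (h' P.toList (nonOverlapping_toList hP.1)
      (fun p hp => hP.2.1 p (Finset.mem_toList.1 hp))
      (fun p hp => hP.2.2.1 p (Finset.mem_toList.1 hp))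
      (fun p hp => hP.2.2.2 p (Finset.mem_toList.1 hp)))).trans ?_
    exact ENNReal.ofReal_toReal_le

theorem isAdditive_of_increment {Φ : ClosedSubinterval → CWK X} {F : I → SupportSpace X}
    (hF : ∀ J, embed (Φ J) = J.increment F) : IsAdditive Φ := by
  intro J K L hJK hL
  have hsub : ∀ M : ClosedSubinterval, (M : Set I) ⊆ L → L.fst ≤ M.fst ∧ M.snd ≤ L.snd :=
    fun M hM => ⟨(hM ⟨le_rfl, M.fst_le_snd⟩).1, (hM ⟨M.fst_le_snd, le_rfl⟩).2⟩
  have hJ := hsub J (hL ▸ subset_union_left)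
  have hK := hsub K (hL ▸ subset_union_right)
  have htiles : Tiles L.fst L.snd [(J, 0), (K, 0)] := by
    refine ⟨by simpa [TaggedList.NonOverlapping] using hJK, ?_, fun x hx hx' =>
      exists_mem_Ico_of_cover (b := L.snd) (fun y hy hy' => ?_) hx hx'⟩
    · intro p hp
      rcases List.mem_cons.1 hp with rfl | hp
      · exact hJ
      · obtain rfl := List.mem_singleton.1 hp
        exact hK
    · have : y ∈ (J : Set I) ∪ K := hL ▸ (⟨hy, hy'⟩ : y ∈ (L : Set I))
      rcases this with h | h
      · exact ⟨(J, 0), by simp, h⟩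
      · exact ⟨(K, 0), by simp, h⟩
  have h1 := htiles.sum_increment L.fst_le_snd F
  have h2 : embed (Φ L) = embed ((Φ J).add (Φ K)) := by
    rw [embed_add, hF, hF, hF]
    simpa [ClosedSubinterval.increment] using h1.symm
  exact congrArg Subtype.val (embed_injective h2)

theorem IsAdditive.exists_increment {Φ : ClosedSubinterval → CWK X} (h : IsAdditive Φ) :
    ∃ F : I → SupportSpace X, ∀ J, embed (Φ J) = J.increment F := by
  refine ⟨fun t => embed (Φ ⟨(0, t), unitInterval.nonneg'⟩), fun J => ?_⟩
  have h1 := h ⟨(0, J.fst), unitInterval.nonneg'⟩ J ⟨(0, J.snd), unitInterval.nonneg'⟩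
    (ClosedSubinterval.nonOverlapping_of_le le_rfl)
    (Icc_union_Icc_eq_Icc unitInterval.nonneg' J.fst_le_snd)
  have h2 : Φ ⟨(0, J.snd), unitInterval.nonneg'⟩ =
      (Φ ⟨(0, J.fst), unitInterval.nonneg'⟩).add (Φ J) := Subtype.ext h1
  rw [ClosedSubinterval.increment, h2, embed_add, add_sub_cancel_left]

theorem norm_embed_sub_smul {Γ : I → CWK X} {Φ : ClosedSubinterval → CWK X}
    {F : I → SupportSpace X} (hF : ∀ J, embed (Φ J) = J.increment F)
    (p : ClosedSubinterval × I) :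
    embed (Φ p.1) - embed ((Γ p.2).smul p.1.length) = defect F (fun t => embed (Γ t)) p := by
  rw [embed_smul p.1.length_nonneg, hF, defect]

/-- The variational Henstock condition for an interval multifunction, stated for partitions of
`[0,1]`, is the variational condition for partitions in `[0,1]` on its support function. -/
theorem variationalHenstock_iff {Γ : I → CWK X} {Φ : ClosedSubinterval → CWK X}
    {F : I → SupportSpace X} (hF : ∀ J, embed (Φ J) = J.increment F) :
    (∀ ε : ℝ, 0 < ε → ∃ δ : I → ℝ, IsGauge δ ∧
      ∀ P : TaggedFamily, P.IsPartitionOf → P.IsPerron → P.IsFine δ →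
        ∑ p ∈ P, Metric.hausdorffEDist (Φ p.1 : Set X) (p.1.length • (Γ p.2 : Set X))
          < ENNReal.ofReal ε) ↔ VariationalHenstock F fun t => embed (Γ t) := by
  classical
  have hsum : ∀ P : TaggedFamily,
      ∑ p ∈ P, Metric.hausdorffEDist (Φ p.1 : Set X) (p.1.length • (Γ p.2 : Set X)) =
        ENNReal.ofReal (P.toList.map fun p => ‖defect F (fun t => embed (Γ t)) p‖).sum := by
    intro P
    have := sum_hausdorffEDist_eq (fun p => Φ p.1) (fun p => (Γ p.2).smul p.1.length) P
    simp only [norm_embed_sub_smul hF] at this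
    exact this
  constructor
  · intro h ε hε
    obtain ⟨δ, hδ, h'⟩ := h ε hε
    refine ⟨δ, hδ, fun L hL hLp hLf => ?_⟩
    set φ : ClosedSubinterval × I → ℝ := fun p => ‖defect F (fun t => embed (Γ t)) p‖ with hφ
    have hφ0 : ∀ p : ClosedSubinterval × I, p.1.snd ≤ p.1.fst → φ p = 0 := fun p hp => by
      rw [hφ]
      exact norm_eq_zero.2 (defect_eq_zero _ _ hp)
    set L' := L.filter fun p => p.1.fst < p.1.snd with hL'
    obtain ⟨R, hR, hRp, hRf⟩ := exists_fine_completion hδ (zero_le_one (α := I)) (hL.filter _)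
      (fun p hp => by simpa using (List.mem_filter.1 hp).2)
      (fun p _ => ⟨unitInterval.nonneg', unitInterval.le_one'⟩) (L := L')
    have h1 := h' _ hR.isPartitionOf
      (fun p hp => ((hLp.filter _).append hRp).rightEnd_cons p (List.mem_toFinset.1 hp))
      (fun p hp => ((hLf.filter _).append hRf).rightEnd_cons hδ p (List.mem_toFinset.1 hp))
    rw [hsum, Finset.sum_map_toList, hR.nonOverlapping.rightEnd_cons.sum_toFinset φ hφ0] at h1
    have h2 := ((ENNReal.ofReal_lt_ofReal_iff hε).1 h1).le
    rw [List.map_cons, List.sum_cons, hφ0 _ le_rfl, zero_add, List.map_append, List.sum_append,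
      sum_map_filter_of_eq_zero _ _ _ fun p _ hp => hφ0 p (by simpa using hp)] at h2
    have h3 : 0 ≤ (R.map φ).sum := List.sum_nonneg fun x hx => by
      obtain ⟨q, _, rfl⟩ := List.mem_map.1 hx
      exact norm_nonneg _
    linarith
  · intro h ε hε
    obtain ⟨δ, hδ, h'⟩ := h (ε / 2) (half_pos hε)
    refine ⟨δ, hδ, fun P hP hPp hPf => ?_⟩
    rw [hsum]
    refine (ENNReal.ofReal_lt_ofReal_iff hε).2 (lt_of_le_of_lt ?_ (half_lt_self hε))
    exact h' P.toList (nonOverlapping_toList hP.1)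
      (fun p hp => hPp p (Finset.mem_toList.1 hp)) (fun p hp => hPf p (Finset.mem_toList.1 hp))

/-- A McShane primitive and a variational Henstock primitive of the same function have the same
increments. -/
theorem TaggedList.SaksHenstock.increment_eq {Y : Type*} [NormedAddCommGroup Y] [NormedSpace ℝ Y]
    {F F' g : I → Y} (h : SaksHenstock F g) (h' : VariationalHenstock F' g)
    (J : ClosedSubinterval) : J.increment F = J.increment F' := by
  refine eq_of_forall_dist_le fun ε hε => ?_
  obtain ⟨δ1, hδ1, h1⟩ := h (ε / 2) (half_pos hε)
  obtain ⟨δ2, hδ2, h2⟩ := h' (ε / 2) (half_pos hε)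
  obtain ⟨L, hL, hLp, hLf⟩ := exists_tiles (isGauge_min hδ1 hδ2) J.fst_le_snd
  have e1 := h1 L hL.nonOverlapping (hLf.mono fun t => min_le_left _ _)
  have e2 := (norm_sum_map_le L (defect F' g)).trans
    (h2 L hL.nonOverlapping hLp (hLf.mono fun t => min_le_right _ _))
  rw [sum_defect, hL.sum_increment J.fst_le_snd, ← dist_eq_norm] at e1 e2
  exact (dist_triangle_right _ _ (riemannSum g L)).trans (by
    show dist (F J.snd - F J.fst) _ + dist (F' J.snd - F' J.fst) _ ≤ ε
    linarith)

/-! ### Bochner measurability -/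

theorem IsSimpleMulti.aestronglyMeasurable {G : I → CWK X} (h : IsSimpleMulti G) :
    AEStronglyMeasurable (fun t => embed (G t)) volume := by
  classical
  have heq : (fun t => embed (G t)) =
      fun t => ∑ A ∈ h.1.toFinset, (G ⁻¹' {A}).indicator (fun _ => embed A) t := by
    funext t
    rw [Finset.sum_eq_single (G t)]
    · rw [indicator_of_mem (by simp)]
    · intro A _ hA
      exact indicator_of_notMem (fun hmem => hA hmem.symm) _
    · intro hmem
      exact absurd (h.1.mem_toFinset.2 ⟨t, rfl⟩) hmem
  rw [heq]
  exact Finset.aestronglyMeasurable_fun_sum _ fun A _ =>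
    aestronglyMeasurable_const.indicator₀ (h.2 A)

/-- A Bochner measurable multifunction is approximated, on countably many measurable sets covering
almost all of `[0,1]`, by the values of simple multifunctions. -/
theorem BochnerMeasurable.exists_countable_cover {Γ : I → CWK X} (h : BochnerMeasurable Γ) {ε : ℝ}
    (hε : 0 < ε) : ∃ D : Set (SupportSpace X), D.Countable ∧
      (∀ y ∈ D, NullMeasurableSet {t | ‖embed (Γ t) - y‖ ≤ ε} (volume : Measure I)) ∧
      ∀ᵐ t : I, ∃ y ∈ D, ‖embed (Γ t) - y‖ ≤ ε := by
  obtain ⟨G, hG, hlim⟩ := h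
  have hmeas : AEStronglyMeasurable (fun t => embed (Γ t)) volume := by
    refine aestronglyMeasurable_of_tendsto_ae atTop (fun n => (hG n).aestronglyMeasurable) ?_
    filter_upwards [hlim] with t ht
    rw [tendsto_iff_edist_tendsto_0]
    simpa only [edist_embed] using ht
  refine ⟨⋃ n, embed '' range (G n), countable_iUnion fun n => ((hG n).1.image _).countable,
    fun y _ => ?_, ?_⟩
  · exact nullMeasurableSet_le (hmeas.sub aestronglyMeasurable_const).norm.aemeasurable
      aemeasurable_const
  · filter_upwards [hlim] with t ht
    obtain ⟨n, hn⟩ := (ht.eventually (gt_mem_nhds (ENNReal.ofReal_pos.2 hε))).exists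
    refine ⟨embed (G n t), mem_iUnion.2 ⟨n, _, ⟨t, rfl⟩, rfl⟩, ?_⟩
    rw [← ofReal_norm_embed_sub] at hn
    rw [norm_sub_rev]
    exact ((ENNReal.ofReal_lt_ofReal_iff_of_nonneg (norm_nonneg _)).1 hn).le

/-- The point `k / (n + 1)` of `[0,1]`, truncated at `1`. -/
noncomputable def gridPoint (n k : ℕ) : I :=
  ⟨min ((k : ℝ) / (n + 1)) 1, le_min (by positivity) zero_le_one, min_le_right _ _⟩

/-- The interval `[k / (n + 1), (k + 1) / (n + 1)]`, truncated at `1`. -/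
noncomputable def gridCell (n k : ℕ) : ClosedSubinterval :=
  ⟨(gridPoint n k, gridPoint n (k + 1)), Subtype.coe_le_coe.1 (min_le_min (by
    gcongr; exact Nat.le_succ k) le_rfl)⟩

theorem mem_gridCell {n : ℕ} {t : I} (ht : t < 1) :
    t ∈ (gridCell n ⌊((n : ℝ) + 1) * t⌋₊ : Set I) ∧
      (gridCell n ⌊((n : ℝ) + 1) * t⌋₊).length = 1 / ((n : ℝ) + 1) := by
  set k := ⌊((n : ℝ) + 1) * t⌋₊ with hk
  have hn : (0 : ℝ) < (n : ℝ) + 1 := by positivity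
  have ht' : (t : ℝ) < 1 := ht
  have hkt : (k : ℝ) ≤ ((n : ℝ) + 1) * t := Nat.floor_le (mul_nonneg hn.le t.2.1)
  have htk : ((n : ℝ) + 1) * t < k + 1 := Nat.lt_floor_add_one _
  have hkn : (k : ℝ) + 1 ≤ n + 1 := by
    have : k < n + 1 := by
      have h1 : (k : ℝ) < ((n + 1 : ℕ) : ℝ) := by
        push_cast
        nlinarith
      exact_mod_cast h1
    exact_mod_cast this
  have e1 : ((gridPoint n k : I) : ℝ) = k / (n + 1) :=
    min_eq_left ((div_le_one hn).2 (by linarith))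
  have e2 : ((gridPoint n (k + 1) : I) : ℝ) = ((k : ℝ) + 1) / (n + 1) := by
    show min (((k + 1 : ℕ) : ℝ) / (n + 1)) 1 = _
    push_cast
    exact min_eq_left ((div_le_one hn).2 hkn)
  refine ⟨⟨?_, ?_⟩, ?_⟩
  · show ((gridPoint n k : I) : ℝ) ≤ t
    rw [e1, div_le_iff₀ hn]
    linarith
  · show (t : ℝ) ≤ (gridPoint n (k + 1) : I)
    rw [e2, le_div_iff₀ hn]
    linarith
  · show ((gridPoint n (k + 1) : I) : ℝ) - (gridPoint n k : I) = _
    rw [e1, e2]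
    ring

/-- If the primitive of `Γ` is almost everywhere differentiable with derivative `Γ`, then the
difference quotients over the cells of a grid are simple multifunctions converging to `Γ`. -/
theorem bochnerMeasurable_of_ae_hasIntervalDeriv {Γ : I → CWK X} {Φ : ClosedSubinterval → CWK X}
    {F : I → SupportSpace X} (hF : ∀ J, embed (Φ J) = J.increment F)
    (h : ∀ᵐ t : I, HasIntervalDeriv F (embed (Γ t)) t) : BochnerMeasurable Γ := by
  set q : ℕ → ℕ → CWK X := fun n k => (Φ (gridCell n k)).smul ((n : ℝ) + 1) with hq
  set ix : ℕ → I → ℕ := fun n t => ⌊((n : ℝ) + 1) * t⌋₊ with hix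
  have hixm : ∀ n, Measurable (ix n) := fun n =>
    Nat.measurable_floor.comp (measurable_subtype_coe.const_mul _)
  refine ⟨fun n t => q n (ix n t), fun n => ⟨?_, fun A => ?_⟩, ?_⟩
  · refine ((finite_Iic (n + 1)).image (q n)).subset ?_
    rintro _ ⟨t, rfl⟩
    refine ⟨ix n t, ?_, rfl⟩
    refine Nat.floor_le_of_le ?_
    push_cast
    exact mul_le_of_le_one_right (by positivity) t.2.2
  · exact ((hixm n) (MeasurableSet.of_discrete (s := q n ⁻¹' {A}))).nullMeasurableSet
  · have h1 : ∀ᵐ t : I, t ≠ 1 := measure_eq_zero_iff_ae_notMem.1 (measure_singleton (1 : I))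
    filter_upwards [h, h1] with t ht ht1
    have htlt : t < 1 := lt_of_le_of_ne unitInterval.le_one' ht1
    simp only [← edist_embed]
    rw [← tendsto_iff_edist_tendsto_0, Metric.tendsto_atTop]
    intro ε hε
    obtain ⟨η, hη, h'⟩ := ht (ε / 2) (half_pos hε)
    obtain ⟨N, hN⟩ := exists_nat_one_div_lt hη
    refine ⟨N, fun n hn => ?_⟩
    have hnpos : (0 : ℝ) < (n : ℝ) + 1 := by positivity
    obtain ⟨hmem, hlen⟩ := mem_gridCell (n := n) htlt
    set J := gridCell n ⌊((n : ℝ) + 1) * t⌋₊ with hJ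
    have hball : (J : Set I) ⊆ Metric.ball t η := by
      intro x hx
      have hx1 : (J.fst : ℝ) ≤ x := hx.1
      have hx2 : (x : ℝ) ≤ J.snd := hx.2
      have ht1 : (J.fst : ℝ) ≤ t := hmem.1
      have ht2 : (t : ℝ) ≤ J.snd := hmem.2
      have h3 : J.length < η := by
        rw [hlen]
        exact (Nat.one_div_le_one_div hn).trans_lt hN
      rw [ClosedSubinterval.length] at h3
      rw [Metric.mem_ball, Subtype.dist_eq, Real.dist_eq, abs_lt]
      constructor <;> linarith
    have h2 := norm_defect_le_of_forall_dist_lt (F := F) (g := fun t => embed (Γ t)) (p := (J, t))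
      h' hmem hball
    have h3 : embed (q n (ix n t)) - embed (Γ t) =
        ((n : ℝ) + 1) • defect F (fun t => embed (Γ t)) (J, t) := by
      show embed ((Φ J).smul ((n : ℝ) + 1)) - embed (Γ t) = _
      rw [embed_smul hnpos.le, hF, defect, smul_sub, smul_smul]
      show _ - _ = _ - (((n : ℝ) + 1) * J.length) • embed (Γ t)
      rw [hlen, mul_one_div_cancel hnpos.ne', one_smul]
    rw [dist_eq_norm, h3, norm_smul, Real.norm_of_nonneg hnpos.le]
    calc ((n : ℝ) + 1) * ‖defect F (fun t => embed (Γ t)) (J, t)‖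
        ≤ ((n : ℝ) + 1) * (ε / 2 * J.length) := by gcongr
      _ = ε / 2 := by
          rw [hlen]
          field_simp
      _ < ε := half_lt_self hε

end Multifunctions

theorem theorem3p3 {X : Type*} [NormedAddCommGroup X] [NormedSpace ℝ X] [CompleteSpace X]
    (Γ : unitInterval → CWK X) (hΓ : McShaneIntegrable Γ) :
    (∃! Φ : ClosedSubinterval → CWK X, IsMcShanePrimitive Γ Φ) ∧
    ∀ Φ : ClosedSubinterval → CWK X, IsMcShanePrimitive Γ Φ →
      (VariationallyHenstockIntegrable Γ ↔
        BochnerMeasurable Γ ∧ VariationalMeasureContinuous Φ) := by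
  obtain ⟨F, hF⟩ := hΓ.riemannCauchy.exists_primitive
  have hSH := TaggedList.saksHenstock hF
  constructor
  · choose Φ hΦ using fun J : ClosedSubinterval =>
      HasMcShaneIntegral.mem_range_embed J.fst_le_snd (hF J.fst J.snd J.fst_le_snd)
    refine ⟨Φ, (isMcShanePrimitive_iff hSH Φ).2 hΦ, fun Φ' hΦ' => funext fun J => ?_⟩
    refine CWK.embed_injective ?_
    rw [(isMcShanePrimitive_iff hSH Φ').1 hΦ' J, hΦ J]
    rfl
  · intro Φ hΦ
    have hinc := (isMcShanePrimitive_iff hSH Φ).1 hΦ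
    rw [variationalMeasureContinuous_iff hinc]
    constructor
    · rintro ⟨Φ', hadd, hΦ'⟩
      obtain ⟨F', hF'⟩ := hadd.exists_increment
      have hVH := (variationalHenstock_iff hF').1 hΦ'
      refine ⟨bochnerMeasurable_of_ae_hasIntervalDeriv hF' hVH.ae_hasIntervalDeriv, ?_⟩
      have hV := hVH.nullVariation
      unfold TaggedList.NullVariation at hV ⊢
      simpa only [hSH.increment_eq hVH] using hV
    · rintro ⟨hB, hV⟩
      have hderiv := hSH.ae_hasIntervalDeriv hV fun ε hε => hB.exists_countable_cover hε
      exact ⟨Φ, isAdditive_of_increment hinc,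
        (variationalHenstock_iff hinc).2 (hV.variationalHenstock hderiv)⟩
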